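/- **Notation.** Fix $w\in C^\infty(\mathbb R)$ with $w\ge 0$, $\operatorname{supp}w\subset[\tfrac12,2]$ and $w(s)=1-w(s/2)$ for $s\in[1,2]$. Let $W_n$, $n\in\mathbb Z$, be the function on $\mathbb R^2$ with Fourier transform $(\mathcal F W_n)(t)=w(\|t\|_2/2^n)$, where $(\mathcal Ff)(t)=\int_{\mathbb R^2} f(x)e^{-i(x,t)}\,dx$, and for a tempered distribution $f$ put $f_n=f*W_n$. The Besov class $B^1_{\infty,1}(\mathbb R^2)$ consists of the tempered distributions $f$ with $$\|f\|_{B^1_{\infty,1}}=\sum_{n\in\mathbb Z}2^n\|f_n\|_{L^\infty(\mathbb R^2)}<\infty\quad\text{and}\quad \frac{\partial f}{\partial x_j}=\sum_{n\in\mathbb Z}\frac{\partial f_n}{\partial x_j}\ \text{ in }\mathcal S'(\mathbb R^2),\quad j=1,2;$$ its elements are continuous functions on $\mathbb R^2$. For such $f$ let $$(\mathfrak D^{[1]}f)(x_1,x_2,y)=\frac{f(x_1,y)-f(x_2,y)}{x_1-x_2},\qquad (\mathfrak D^{[2]}f)(x,y_1,y_2)=\frac{f(x,y_1)-f(x,y_2)}{y_1-y_2},$$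 where the quotients are understood as $\frac{\partial f}{\partial x}(x_1,y)$ if $x_1=x_2$ and as $\frac{\partial f}{\partial y}(x,y_1)$ if $y_1=y_2$. Let $E_1,E_2,E_3$ be spectral (i.e. projection-valued) measures on the Borel subsets of $\mathbb R$, with values in the orthogonal projections of a Hilbert space. Let $\mathcal B$ be the space of matrices $\{b_{jk}\}_{j,k\ge0}$ that induce bounded operators on $\ell^2$, with the operator norm; for families of measurable functions, $L^\infty_{E}(\ell^2)$ and $L^\infty_{E}(\mathcal B)$ are normed by the $E$-essential supremum of the $\ell^2$ norm and of the $\mathcal B$ norm, respectively. Write $\sum_{j,k\ge0}=\lim_{M,N\to\infty}\sum_{j=0}^N\sum_{k=0}^M$. A function $\Psi$ on $\mathbb R^3$ belongs to the *Haagerup-like tensor product of the first kind* $L^\infty(E_1)\otimes_{\rm h}L^\infty(E_2)\otimes^{\rm h}L^\infty(E_3)$ if $$\Psi(x_1,x_2,x_3)=\sum_{j,k\ge0}\alpha_j(x_1)\beta_k(x_2)\gamma_{jk}(x_3),\qquad x_1,x_2,x_3\in\mathbb R,$$ for some $\{\alpha_j\}\in L^\infty_{E_1}(\ell^2)$, $\{\beta_k\}\in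 L^\infty_{E_2}(\ell^2)$, $\{\gamma_{jk}\}\in L^\infty_{E_3}(\mathcal B)$, and to that *of the second kind* $L^\infty(E_1)\otimes^{\rm h}L^\infty(E_2)\otimes_{\rm h}L^\infty(E_3)$ if $$\Psi(x_1,x_2,x_3)=\sum_{j,k\ge0}\alpha_{jk}(x_1)\beta_j(x_2)\gamma_k(x_3),\qquad x_1,x_2,x_3\in\mathbb R,$$ for some $\{\alpha_{jk}\}\in L^\infty_{E_1}(\mathcal B)$, $\{\beta_j\}\in L^\infty_{E_2}(\ell^2)$, $\{\gamma_k\}\in L^\infty_{E_3}(\ell^2)$. In each case the norm of $\Psi$ is the infimum, over all such representations, of the product of the three norms. **Theorem 6.3.** There is a constant $C$ such that for every $f\in B^1_{\infty,1}(\mathbb R^2)$ the partial derivatives of $f$ exist everywhere (so that $\mathfrak D^{[1]}f$ and $\mathfrak D^{[2]}f$ are defined on $\mathbb R^3$) and, for arbitrary Borel spectral measures $E_1,E_2,E_3$ on $\mathbb R$, $$\mathfrak D^{[1]}f\in L^\infty(E_1)\otimes_{\rm h}L^\infty(E_2)\otimes^{\rm h}L^\infty(E_3),\qquad \mathfrak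 D^{[2]}f\in L^\infty(E_1)\otimes^{\rm h}L^\infty(E_2)\otimes_{\rm h}L^\infty(E_3),$$ $$\big\|\mathfrak D^{[1]}f\big\|_{L^\infty\otimes_{\rm h}L^\infty\otimes^{\rm h}L^\infty}\le C\,\|f\|_{B^1_{\infty,1}},\qquad \big\|\mathfrak D^{[2]}f\big\|_{L^\infty\otimes^{\rm h}L^\infty\otimes_{\rm h}L^\infty}\le C\,\|f\|_{B^1_{\infty,1}}.$$ The constant $C$ does not depend on $w$, $f$, the Hilbert space, or $E_1,E_2,E_3$. -/

import Mathlib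

open MeasureTheory Filter Topology
open scoped ENNReal NNReal ContDiff SchwartzMap LineDeriv

noncomputable section

/-! ## The Besov class `B^1_{∞,1}(ℝ²)` -/

/-- The Euclidean plane. -/
abbrev Plane : Type := EuclideanSpace ℝ (Fin 2)

/-- The cut-off functions used to build Littlewood–Paley expansions: `w` is smooth, nonnegative,
supported in `[1/2, 2]`, and `w s = 1 - w (s / 2)` on `[1, 2]`. -/
structure IsLittlewoodPaleyCutoff (w : ℝ → ℝ) : Prop where
  contDiff : ContDiff ℝ ∞ w
  nonneg : ∀ s, 0 ≤ w s
  support_subset : tsupport w ⊆ Set.Icc (1 / 2) 2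
  partition : ∀ s ∈ Set.Icc (1 : ℝ) 2, w s = 1 - w (s / 2)

/-- The `n`-th Littlewood–Paley piece `u_n = u * W_n` of a tempered distribution `u`, where the
Fourier transform of `W_n` is `t ↦ w (‖t‖ / 2 ^ n)` for the normalization
`(ℱ g)(t) = ∫ g(x) e^{-i(x,t)} dx`. Mathlib's Fourier transform has `e^{-2πi(x,ξ)}` instead, that is
`t = 2πξ`, which explains the factor `2π`. -/
def lpPiece (w : ℝ → ℝ) (n : ℤ) (u : 𝓢'(Plane, ℂ)) : 𝓢'(Plane, ℂ) :=
  TemperedDistribution.fourierMultiplierCLM ℂ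
    (fun ξ : Plane => ((w (‖(2 * Real.pi) • ξ‖ / (2 : ℝ) ^ n) : ℝ) : ℂ)) u

/-- The `L^∞` norm of a tempered distribution; it is `∞` if the distribution is not given by an
`L^∞` function. -/
def distLinftyNorm (u : 𝓢'(Plane, ℂ)) : ℝ≥0∞ :=
  ⨅ (g : Lp ℂ ⊤ (volume : Measure Plane)) (_ : Lp.toTemperedDistribution g = u), ‖g‖ₑ

/-- The (semi)norm `∑_{n ∈ ℤ} 2 ^ n ‖u_n‖_{L^∞}` of `B^1_{∞,1}(ℝ²)`. -/
def besovNorm (w : ℝ → ℝ) (u : 𝓢'(Plane, ℂ)) : ℝ≥0∞ :=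
  ∑' n : ℤ, (2 : ℝ≥0∞) ^ n * distLinftyNorm (lpPiece w n u)

/-- The (modified homogeneous) Besov class `B^1_{∞,1}(ℝ²)`: the norm is finite, and the first order
partial derivatives are recovered from the Littlewood–Paley expansion in the space of tempered
distributions. -/
structure MemBesov (w : ℝ → ℝ) (u : 𝓢'(Plane, ℂ)) : Prop where
  norm_lt_top : besovNorm w u < ⊤
  hasSum_deriv : ∀ j : Fin 2,
    HasSum (fun n : ℤ => ∂_{(EuclideanSpace.single j 1 : Plane)} (lpPiece w n u))
      (∂_{(EuclideanSpace.single j 1 : Plane)} u)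

/-- The tempered distribution `u` is given by the (continuous) function `f`, as usual by testing
against compactly supported smooth functions. -/
def IsGivenBy (u : 𝓢'(Plane, ℂ)) (f : Plane → ℂ) : Prop :=
  ∀ φ : 𝓢(Plane, ℂ), HasCompactSupport φ → u φ = ∫ x, φ x * f x

/-! ## Divided differences -/

/-- `(f(x₁, y) - f(x₂, y)) / (x₁ - x₂)`, understood as `∂f/∂x (x₁, y)` if `x₁ = x₂`. -/
def dividedDiff₁ (f : Plane → ℂ) (x₁ x₂ y : ℝ) : ℂ :=
  if x₁ = x₂ then deriv (fun t : ℝ => f !₂[t, y]) x₁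
  else (f !₂[x₁, y] - f !₂[x₂, y]) / ((x₁ - x₂ : ℝ) : ℂ)

/-- `(f(x, y₁) - f(x, y₂)) / (y₁ - y₂)`, understood as `∂f/∂y (x, y₁)` if `y₁ = y₂`. -/
def dividedDiff₂ (f : Plane → ℂ) (x y₁ y₂ : ℝ) : ℂ :=
  if y₁ = y₂ then deriv (fun t : ℝ => f !₂[x, t]) y₁
  else (f !₂[x, y₁] - f !₂[x, y₂]) / ((y₁ - y₂ : ℝ) : ℂ)

/-! ## Spectral measures and the associated `L^∞` norms -/

/-- A spectral measure: a strongly countably additive measure whose values are orthogonal projections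
on the Hilbert space `H`, with the identity as its total value. (Only the values on measurable sets
matter.) -/
structure SpectralMeasure (X : Type*) [MeasurableSpace X] (H : Type*) [NormedAddCommGroup H]
    [InnerProductSpace ℂ H] [CompleteSpace H] where
  proj : Set X → H →L[ℂ] H
  isStarProjection : ∀ s, MeasurableSet s → IsStarProjection (proj s)
  proj_univ : proj Set.univ = 1
  hasSum_proj : ∀ s : ℕ → Set X, (∀ i, MeasurableSet (s i)) →
    Pairwise (Function.onFun Disjoint s) →
    ∀ v : H, HasSum (fun i => proj (s i) v) (proj (⋃ i, s i) v)

section Haagerup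

variable {X X₁ X₂ X₃ : Type*} [MeasurableSpace X] [MeasurableSpace X₁] [MeasurableSpace X₂]
  [MeasurableSpace X₃] {H : Type*} [NormedAddCommGroup H] [InnerProductSpace ℂ H] [CompleteSpace H]

/-- `E`-essential supremum of a nonnegative function. -/
def SpectralMeasure.essSup (E : SpectralMeasure X H) (g : X → ℝ≥0∞) : ℝ≥0∞ :=
  sInf {c | ∃ N : Set X, MeasurableSet N ∧ E.proj N = 0 ∧ ∀ x ∉ N, g x ≤ c}

/-- The `ℓ²` norm of a sequence (`∞` if it is not square summable). -/
def ell2Norm (a : ℕ → ℂ) : ℝ≥0∞ := (∑' j, ‖a j‖ₑ ^ 2) ^ (1 / 2 : ℝ)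

/-- The norm of an infinite matrix in the space `ℬ` of matrices that induce bounded operators on
`ℓ²`: the norm of the operator with this matrix, and `∞` if there is no such operator. -/
def matrixNorm (b : ℕ → ℕ → ℂ) : ℝ≥0∞ :=
  ⨅ (T : lp (fun _ : ℕ => ℂ) 2 →L[ℂ] lp (fun _ : ℕ => ℂ) 2)
    (_ : ∀ j k : ℕ, T (lp.single 2 k (1 : ℂ)) j = b j k), ‖T‖ₑ

/-- The norm of `{a_j}` in `L^∞_E(ℓ²)`. -/
def SpectralMeasure.seqNorm (E : SpectralMeasure X H) (a : ℕ → X → ℂ) : ℝ≥0∞ :=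
  E.essSup fun x => ell2Norm fun j => a j x

/-- The norm of `{b_{jk}}` in `L^∞_E(ℬ)`. -/
def SpectralMeasure.matNorm (E : SpectralMeasure X H) (b : ℕ → ℕ → X → ℂ) : ℝ≥0∞ :=
  E.essSup fun x => matrixNorm fun j k => b j k x

/-- Representations
`Ψ(x₁, x₂, x₃) = lim_{M, N → ∞} ∑_{j < N} ∑_{k < M} α_j(x₁) β_k(x₂) γ_{jk}(x₃)` with
`{α_j} ∈ L^∞_{E₁}(ℓ²)`, `{β_k} ∈ L^∞_{E₂}(ℓ²)` and `{γ_{jk}} ∈ L^∞_{E₃}(ℬ)`. -/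
structure FirstKindRep (E₁ : SpectralMeasure X₁ H) (E₂ : SpectralMeasure X₂ H)
    (E₃ : SpectralMeasure X₃ H) (Ψ : X₁ → X₂ → X₃ → ℂ) where
  α : ℕ → X₁ → ℂ
  β : ℕ → X₂ → ℂ
  γ : ℕ → ℕ → X₃ → ℂ
  measurable_α : ∀ j, Measurable (α j)
  measurable_β : ∀ k, Measurable (β k)
  measurable_γ : ∀ j k, Measurable (γ j k)
  α_lt_top : E₁.seqNorm α < ⊤
  β_lt_top : E₂.seqNorm β < ⊤
  γ_lt_top : E₃.matNorm γ < ⊤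
  tendsto : ∀ x₁ x₂ x₃,
    Tendsto (fun p : ℕ × ℕ => ∑ j ∈ Finset.range p.1, ∑ k ∈ Finset.range p.2,
      α j x₁ * β k x₂ * γ j k x₃) atTop (𝓝 (Ψ x₁ x₂ x₃))

/-- `Ψ` belongs to the Haagerup-like tensor product of the first kind. -/
def MemFirstKind (E₁ : SpectralMeasure X₁ H) (E₂ : SpectralMeasure X₂ H)
    (E₃ : SpectralMeasure X₃ H) (Ψ : X₁ → X₂ → X₃ → ℂ) : Prop :=
  Nonempty (FirstKindRep E₁ E₂ E₃ Ψ)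

/-- The norm in the Haagerup-like tensor product of the first kind. -/
def firstKindNorm (E₁ : SpectralMeasure X₁ H) (E₂ : SpectralMeasure X₂ H)
    (E₃ : SpectralMeasure X₃ H) (Ψ : X₁ → X₂ → X₃ → ℂ) : ℝ≥0∞ :=
  ⨅ r : FirstKindRep E₁ E₂ E₃ Ψ, E₁.seqNorm r.α * E₂.seqNorm r.β * E₃.matNorm r.γ

/-- Representations
`Ψ(x₁, x₂, x₃) = lim_{M, N → ∞} ∑_{j < N} ∑_{k < M} α_{jk}(x₁) β_j(x₂) γ_k(x₃)` with
`{α_{jk}} ∈ L^∞_{E₁}(ℬ)`, `{β_j} ∈ L^∞_{E₂}(ℓ²)` and `{γ_k} ∈ L^∞_{E₃}(ℓ²)`. -/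
structure SecondKindRep (E₁ : SpectralMeasure X₁ H) (E₂ : SpectralMeasure X₂ H)
    (E₃ : SpectralMeasure X₃ H) (Ψ : X₁ → X₂ → X₃ → ℂ) where
  α : ℕ → ℕ → X₁ → ℂ
  β : ℕ → X₂ → ℂ
  γ : ℕ → X₃ → ℂ
  measurable_α : ∀ j k, Measurable (α j k)
  measurable_β : ∀ j, Measurable (β j)
  measurable_γ : ∀ k, Measurable (γ k)
  α_lt_top : E₁.matNorm α < ⊤
  β_lt_top : E₂.seqNorm β < ⊤
  γ_lt_top : E₃.seqNorm γ < ⊤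
  tendsto : ∀ x₁ x₂ x₃,
    Tendsto (fun p : ℕ × ℕ => ∑ j ∈ Finset.range p.1, ∑ k ∈ Finset.range p.2,
      α j k x₁ * β j x₂ * γ k x₃) atTop (𝓝 (Ψ x₁ x₂ x₃))

/-- `Ψ` belongs to the Haagerup-like tensor product of the second kind. -/
def MemSecondKind (E₁ : SpectralMeasure X₁ H) (E₂ : SpectralMeasure X₂ H)
    (E₃ : SpectralMeasure X₃ H) (Ψ : X₁ → X₂ → X₃ → ℂ) : Prop :=
  Nonempty (SecondKindRep E₁ E₂ E₃ Ψ)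

/-- The norm in the Haagerup-like tensor product of the second kind. -/
def secondKindNorm (E₁ : SpectralMeasure X₁ H) (E₂ : SpectralMeasure X₂ H)
    (E₃ : SpectralMeasure X₃ H) (Ψ : X₁ → X₂ → X₃ → ℂ) : ℝ≥0∞ :=
  ⨅ r : SecondKindRep E₁ E₂ E₃ Ψ, E₁.matNorm r.α * E₂.seqNorm r.β * E₃.seqNorm r.γ

end Haagerup

end

/-! Freeze one variable. What remains is the divided difference of a function of one variable, and
the task is to factor it through `ℓ²` with a bounded middle matrix.

For one band-limited function `φ`, write the divided difference as `∫₀¹ φ'(s x₁ + (1 - s) x₂) ds`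
(`lineDiff_eq_integral`). For fixed `s` the integrand is band-limited in `x₁` and in `x₂`, so it can
be sampled at the integers in both variables with a rapidly decreasing kernel `K`. After integration
this reads `∑ K(x₁ - j) K(x₂ - k) D(j, k)`, where `D` is the divided difference at integer points
(`hasSum_lineDiff`). The vectors `K(x - j)` are bounded in `ℓ²` uniformly in `x`. The matrix `D` has
entries `(φ(j) - φ(k)) / (j - k)` off the diagonal and `φ'(j)` on it; it is bounded by Hilbert's
inequality, with norm controlled by the sup norms of `φ` and `φ'` (`bilinearBound_lineDiff`).

The `n`-th Littlewood–Paley piece, dilated by `2 ^ (n + 1)`, is a bounded function correlated with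
one fixed Schwartz kernel (`exists_lpPiece_eq_correl`), so these bounds hold for all pieces with a
constant times `‖f_n‖_∞`. Undoing the dilation multiplies the divided difference by `2 ^ (n + 1)`.
The pieces are glued with a block diagonal matrix: each of the two vectors carries the square root
of `2 ^ (n + 1) ‖f_n‖_∞`, and the normalized matrices are the blocks
(`exists_haagerup_representation`). The squared `ℓ²` norms then add up to a multiple of the Besov
norm, while the matrix norm stays a constant.

It remains to expand the divided difference of `f` itself. The series of derivatives of the pieces
converges uniformly to a continuous function which is the weak derivative of `f`; mollification
turns it into the classical one (`sub_eq_intervalIntegral_of_weak`). All bounds hold at every point,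
so the spectral measures play no role in them. -/

noncomputable section

/-! ## Bounded bilinear forms on finitely supported sequences -/

/-- The matrix `b` defines a bilinear form of norm at most `C` on finitely supported `ℓ²`
sequences. -/
def BilinearBound {ι : Type*} (b : ι → ι → ℂ) (C : ℝ) : Prop :=
  ∀ (s : Finset ι) (x y : ι → ℂ), ‖∑ j ∈ s, ∑ k ∈ s, x j * b j k * y k‖ ≤
    C * (√(∑ j ∈ s, ‖x j‖ ^ 2) * √(∑ k ∈ s, ‖y k‖ ^ 2))

namespace BilinearBound

variable {ι κ : Type*}

/-- Duality: testing the form against the conjugate of the vector `r = b y` gives `‖r‖² ≤ C ‖r‖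
‖y‖`. The two index sets are merged by extending `y` by zero. -/
theorem sum_sq_le {b : ι → ι → ℂ} {C : ℝ} (hb : BilinearBound b C) (hC : 0 ≤ C)
    (s t : Finset ι) (y : ι → ℂ) :
    ∑ j ∈ s, ‖∑ k ∈ t, b j k * y k‖ ^ 2 ≤ C ^ 2 * ∑ k ∈ t, ‖y k‖ ^ 2 := by
  classical
  set r : ι → ℂ := fun j => ∑ k ∈ t, b j k * y k with hr
  set y' : ι → ℂ := fun k => if k ∈ t then y k else 0 with hy'
  set S := ∑ j ∈ s ∪ t, ‖r j‖ ^ 2 with hS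
  have hS0 : 0 ≤ S := Finset.sum_nonneg fun _ _ => by positivity
  have hY : ∑ k ∈ s ∪ t, ‖y' k‖ ^ 2 = ∑ k ∈ t, ‖y k‖ ^ 2 := by
    rw [← Finset.sum_subset Finset.subset_union_right]
    · exact Finset.sum_congr rfl fun k hk => by simp [hy', hk]
    · intro k _ hk; simp [hy', hk]
  have hR : ∀ j, ∑ k ∈ s ∪ t, b j k * y' k = r j := by
    intro j
    rw [hr, ← Finset.sum_subset Finset.subset_union_right]
    · exact Finset.sum_congr rfl fun k hk => by simp [hy', hk]
    · intro k _ hk; simp [hy', hk]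
  have key := hb (s ∪ t) (fun j => starRingEnd ℂ (r j)) y'
  simp_rw [mul_assoc, ← Finset.mul_sum, hR, hY, RCLike.norm_conj] at key
  have e : ∑ j ∈ s ∪ t, starRingEnd ℂ (r j) * r j = (S : ℂ) := by
    rw [hS, Complex.ofReal_sum]
    refine Finset.sum_congr rfl fun j _ => ?_
    rw [mul_comm, Complex.mul_conj, Complex.normSq_eq_norm_sq]
  rw [e, Complex.norm_real, Real.norm_of_nonneg hS0] at key
  set Y := ∑ k ∈ t, ‖y k‖ ^ 2 with hYdef
  have hY0 : 0 ≤ Y := Finset.sum_nonneg fun _ _ => by positivity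
  have h3 : S ≤ C ^ 2 * Y := by
    have h1 := Real.sq_sqrt hS0
    have h2 := Real.sq_sqrt hY0
    have h4 : √S ≤ C * √Y := by
      rcases (Real.sqrt_nonneg S).eq_or_lt with h | h
      · rw [← h]; positivity
      · refine le_of_mul_le_mul_left ?_ h
        nlinarith
    calc S = √S ^ 2 := h1.symm
      _ ≤ (C * √Y) ^ 2 := by gcongr
      _ = C ^ 2 * Y := by rw [mul_pow, h2]
  exact (Finset.sum_le_sum_of_subset_of_nonneg Finset.subset_union_left
    fun _ _ _ => by positivity).trans h3

theorem reindex {b : ι → ι → ℂ} {C : ℝ} (hb : BilinearBound b C) (e : κ ≃ ι) :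
    BilinearBound (fun j k => b (e j) (e k)) C := by
  intro s x y
  have := hb (s.map e.toEmbedding) (x ∘ e.symm) (y ∘ e.symm)
  simpa [Finset.sum_map] using this

theorem const_mul {b : ι → ι → ℂ} {C : ℝ} (hb : BilinearBound b C) (c : ℂ) :
    BilinearBound (fun j k => c * b j k) (‖c‖ * C) := by
  intro s x y
  have : ∑ j ∈ s, ∑ k ∈ s, x j * (c * b j k) * y k
      = c * ∑ j ∈ s, ∑ k ∈ s, x j * b j k * y k := by
    simp_rw [Finset.mul_sum]
    exact Finset.sum_congr rfl fun _ _ => Finset.sum_congr rfl fun _ _ => by ring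
  rw [this, norm_mul, mul_assoc]
  gcongr
  exact hb s x y

theorem add {b b' : ι → ι → ℂ} {C C' : ℝ} (hb : BilinearBound b C) (hb' : BilinearBound b' C') :
    BilinearBound (fun j k => b j k + b' j k) (C + C') := by
  intro s x y
  have : ∑ j ∈ s, ∑ k ∈ s, x j * (b j k + b' j k) * y k
      = ∑ j ∈ s, ∑ k ∈ s, x j * b j k * y k + ∑ j ∈ s, ∑ k ∈ s, x j * b' j k * y k := by
    simp_rw [← Finset.sum_add_distrib]
    exact Finset.sum_congr rfl fun _ _ => Finset.sum_congr rfl fun _ _ => by ring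
  rw [this, add_mul]
  exact (norm_add_le _ _).trans (add_le_add (hb s x y) (hb' s x y))

theorem mono {b : ι → ι → ℂ} {C C' : ℝ} (hb : BilinearBound b C) (h : C ≤ C') :
    BilinearBound b C' := fun s x y => (hb s x y).trans (by gcongr)

theorem sqrt_sum_mul_le (s : Finset ι) (a x : ι → ℂ) {A : ℝ} (hA : 0 ≤ A) (ha : ∀ j, ‖a j‖ ≤ A) :
    √(∑ j ∈ s, ‖x j * a j‖ ^ 2) ≤ A * √(∑ j ∈ s, ‖x j‖ ^ 2) := by
  rw [← Real.sqrt_sq hA, ← Real.sqrt_mul (by positivity), Finset.mul_sum]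
  gcongr with j _
  rw [norm_mul, mul_pow, mul_comm]
  gcongr
  exact ha j

theorem left_mul {b : ι → ι → ℂ} {C A : ℝ} (hb : BilinearBound b C) (hC : 0 ≤ C) (a : ι → ℂ)
    (hA : 0 ≤ A) (ha : ∀ j, ‖a j‖ ≤ A) : BilinearBound (fun j k => a j * b j k) (A * C) := by
  intro s x y
  have := hb s (fun j => x j * a j) y
  simp_rw [mul_assoc] at this ⊢
  refine this.trans ?_
  have := sqrt_sum_mul_le s a x hA ha
  calc _ ≤ C * ((A * √(∑ j ∈ s, ‖x j‖ ^ 2)) * √(∑ k ∈ s, ‖y k‖ ^ 2)) := by gcongr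
    _ = _ := by ring

theorem right_mul {b : ι → ι → ℂ} {C A : ℝ} (hb : BilinearBound b C) (hC : 0 ≤ C) (a : ι → ℂ)
    (hA : 0 ≤ A) (ha : ∀ j, ‖a j‖ ≤ A) : BilinearBound (fun j k => a k * b j k) (A * C) := by
  intro s x y
  have := hb s x (fun k => y k * a k)
  have e : ∀ j k, x j * (a k * b j k) * y k = x j * b j k * (y k * a k) := fun _ _ => by ring
  simp_rw [e]
  refine this.trans ?_
  have := sqrt_sum_mul_le s a y hA ha
  calc _ ≤ C * (√(∑ j ∈ s, ‖x j‖ ^ 2) * (A * √(∑ k ∈ s, ‖y k‖ ^ 2))) := by gcongr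
    _ = _ := by ring

theorem diagonal [DecidableEq ι] (d : ι → ℂ) {D : ℝ} (hD : 0 ≤ D) (hd : ∀ j, ‖d j‖ ≤ D) :
    BilinearBound (fun j k => if j = k then d j else 0) D := by
  intro s x y
  have e : ∑ j ∈ s, ∑ k ∈ s, x j * (if j = k then d j else 0) * y k
      = ∑ j ∈ s, (x j * d j) * y j := by
    refine Finset.sum_congr rfl fun j hj => ?_
    simp [hj]
  rw [e]
  have h1 : ‖∑ j ∈ s, (x j * d j) * y j‖ ≤ ∑ j ∈ s, ‖x j * d j‖ * ‖y j‖ :=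
    (norm_sum_le _ _).trans (by simp_rw [norm_mul]; rfl)
  refine h1.trans ((Real.sum_mul_le_sqrt_mul_sqrt _ _ _).trans ?_)
  rw [← mul_assoc]
  gcongr
  exact sqrt_sum_mul_le s d x hD hd

/-- The norm of a direct sum is the supremum of the norms: estimate each block, then apply
Cauchy–Schwarz over the blocks. -/
theorem blockDiagonal [DecidableEq ι] (b : ι → κ → κ → ℂ) {C : ℝ} (hC : 0 ≤ C)
    (hb : ∀ n, BilinearBound (b n) C) :
    BilinearBound (fun p q : ι × κ => if p.1 = q.1 then b p.1 p.2 q.2 else 0) C := by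
  classical
  intro s x y
  set N := s.image Prod.fst
  set J := s.image Prod.snd
  -- The set `s` need not be a product; extension by zero to the enclosing rectangle makes the sum
  -- split into blocks.
  have hsub : s ⊆ N ×ˢ J := fun p hp => Finset.mem_product.2
    ⟨Finset.mem_image_of_mem _ hp, Finset.mem_image_of_mem _ hp⟩
  set x' : ι × κ → ℂ := fun p => if p ∈ s then x p else 0 with hx'
  set y' : ι × κ → ℂ := fun p => if p ∈ s then y p else 0 with hy'
  have e1 : ∑ p ∈ s, ∑ q ∈ s, x p * (if p.1 = q.1 then b p.1 p.2 q.2 else 0) * y q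
      = ∑ p ∈ N ×ˢ J, ∑ q ∈ N ×ˢ J,
        x' p * (if p.1 = q.1 then b p.1 p.2 q.2 else 0) * y' q := by
    rw [← Finset.sum_subset hsub]
    · refine Finset.sum_congr rfl fun p hp => ?_
      rw [← Finset.sum_subset hsub]
      · refine Finset.sum_congr rfl fun q hq => ?_
        simp only [hx', hy', hp, hq, if_true]
      · intro q _ hq; simp only [hy', hq, if_false, mul_zero]
    · intro p _ hp; simp only [hx', hp, if_false, zero_mul, Finset.sum_const_zero]
  have e2 : ∑ p ∈ N ×ˢ J, ∑ q ∈ N ×ˢ J,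
        x' p * (if p.1 = q.1 then b p.1 p.2 q.2 else 0) * y' q
      = ∑ n ∈ N, ∑ j ∈ J, ∑ k ∈ J, x' (n, j) * b n j k * y' (n, k) := by
    rw [Finset.sum_product]
    refine Finset.sum_congr rfl fun n hn => Finset.sum_congr rfl fun j _ => ?_
    rw [Finset.sum_product, Finset.sum_eq_single n]
    · simp
    · intro m _ hm; simp [hm.symm]
    · exact fun h => absurd hn h
  have e3 : ∀ z : ι × κ → ℂ, ∑ n ∈ N, ∑ j ∈ J, ‖(fun p => if p ∈ s then z p else 0) (n, j)‖ ^ 2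
      = ∑ p ∈ s, ‖z p‖ ^ 2 := by
    intro z
    rw [← Finset.sum_product' (f := fun n j => ‖(fun p => if p ∈ s then z p else 0) (n, j)‖ ^ 2),
      ← Finset.sum_subset hsub]
    · exact Finset.sum_congr rfl fun p hp => by simp [hp]
    · intro p _ hp; simp [hp]
  rw [e1, e2, ← e3 x, ← e3 y]
  calc _ ≤ ∑ n ∈ N, ‖∑ j ∈ J, ∑ k ∈ J, x' (n, j) * b n j k * y' (n, k)‖ := norm_sum_le _ _
    _ ≤ ∑ n ∈ N, C * (√(∑ j ∈ J, ‖x' (n, j)‖ ^ 2) * √(∑ j ∈ J, ‖y' (n, j)‖ ^ 2)) :=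
      Finset.sum_le_sum fun n _ => hb n J (fun j => x' (n, j)) (fun j => y' (n, j))
    _ ≤ _ := by
      rw [← Finset.mul_sum]
      gcongr
      refine (Real.sum_sqrt_mul_sqrt_le N (fun n => ?_) (fun n => ?_)) <;> positivity

/-- The rows are square summable (test against a conjugated row), so the matrix acts on `ℓ²` by
convergent series, and the finite-section estimate passes to the limit. -/
theorem matrixNorm_le {b : ℕ → ℕ → ℂ} {C : ℝ} (hb : BilinearBound b C) (hC : 0 ≤ C) :
    matrixNorm b ≤ ENNReal.ofReal C := by
  have hrow : ∀ j, Summable fun k => ‖b j k‖ ^ 2 := by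
    intro j
    refine summable_of_sum_le (c := C ^ 2) (fun _ => by positivity) fun t => ?_
    have h := hb.sum_sq_le hC {j} t fun k => starRingEnd ℂ (b j k)
    have e : ∑ k ∈ t, b j k * starRingEnd ℂ (b j k) = ((∑ k ∈ t, ‖b j k‖ ^ 2 : ℝ) : ℂ) := by
      push_cast
      exact Finset.sum_congr rfl fun k _ => by
        rw [Complex.mul_conj, Complex.normSq_eq_norm_sq]; norm_cast
    have h0 : 0 ≤ ∑ k ∈ t, ‖b j k‖ ^ 2 := Finset.sum_nonneg fun _ _ => by positivity
    simp only [Finset.sum_singleton, e, Complex.norm_real, Real.norm_of_nonneg h0,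
      RCLike.norm_conj] at h
    rcases h0.eq_or_lt with h1 | h1
    · rw [← h1]; positivity
    · rw [sq] at h; exact le_of_mul_le_mul_right h h1
  have hsq : ∀ x : lp (fun _ : ℕ => ℂ) 2, Summable fun k => ‖x k‖ ^ 2 := by
    intro x
    have := (memℓp_gen_iff (by norm_num)).1 (lp.memℓp x)
    simpa using this
  have hnsq : ∀ x : lp (fun _ : ℕ => ℂ) 2, ‖x‖ ^ 2 = ∑' k, ‖x k‖ ^ 2 := by
    intro x
    have := lp.norm_rpow_eq_tsum (p := 2) (by norm_num) x
    simpa using this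
  have hsum : ∀ (x : lp (fun _ : ℕ => ℂ) 2) j, Summable fun k => b j k * x k := by
    intro x j
    refine Summable.of_norm_bounded ((hrow j).add (hsq x)) fun k => ?_
    rw [norm_mul]
    nlinarith [sq_nonneg (‖b j k‖ - ‖x k‖), sq_nonneg ‖b j k‖, sq_nonneg ‖x k‖]
  have hle : ∀ (x : lp (fun _ : ℕ => ℂ) 2) (s : Finset ℕ),
      ∑ j ∈ s, ‖∑' k, b j k * x k‖ ^ 2 ≤ (C * ‖x‖) ^ 2 := by
    intro x s
    refine le_of_tendsto (tendsto_finsetSum s fun j _ => ((hsum x j).hasSum.norm.pow 2)) ?_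
    refine Eventually.of_forall fun t => (hb.sum_sq_le hC s t x).trans ?_
    rw [mul_pow, hnsq]
    gcongr
    exact (hsq x).sum_le_tsum _ fun _ _ => by positivity
  have hmem : ∀ x : lp (fun _ : ℕ => ℂ) 2, Memℓp (fun j => ∑' k, b j k * x k) 2 := by
    intro x
    refine memℓp_gen' (C := (C * ‖x‖) ^ 2) fun s => ?_
    simpa using hle x s
  let L : lp (fun _ : ℕ => ℂ) 2 →ₗ[ℂ] lp (fun _ : ℕ => ℂ) 2 :=
    { toFun := fun x => ⟨fun j => ∑' k, b j k * x k, hmem x⟩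
      map_add' := fun x y => by
        ext j
        simp only [lp.coeFn_add, Pi.add_apply, mul_add]
        exact (hsum x j).tsum_add (hsum y j)
      map_smul' := fun c x => by
        ext j
        simp only [lp.coeFn_smul, Pi.smul_apply, smul_eq_mul, RingHom.id_apply, ← tsum_mul_left]
        exact tsum_congr fun k => by ring }
  have hL : ∀ x, ‖L x‖ ≤ C * ‖x‖ := by
    intro x
    refine lp.norm_le_of_forall_sum_le (by norm_num) (by positivity) fun s => ?_
    simpa [L] using hle x s
  refine (iInf₂_le (L.mkContinuous C hL) fun j k => ?_).trans ?_
  · change ∑' l, b j l * (lp.single 2 k (1 : ℂ) : ℕ → ℂ) l = b j k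
    rw [tsum_eq_single k]
    · simp
    · intro l hl; simp [hl]
  · rw [← ofReal_norm]
    exact ENNReal.ofReal_le_ofReal (L.mkContinuous_norm_le hC hL)

end BilinearBound

/-! ## Hilbert's inequality -/

open Complex in
theorem intervalIntegral_exp_int (m : ℤ) :
    ∫ t in (0 : ℝ)..1, Complex.exp (2 * Real.pi * I * m * t) = if m = 0 then 1 else 0 := by
  split_ifs with h
  · simp [h]
  · have hc : (2 * Real.pi * I * m : ℂ) ≠ 0 := by
      simp [h, Real.pi_ne_zero]
    rw [integral_exp_mul_complex hc]
    have : Complex.exp (2 * Real.pi * I * m) = 1 := by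
      rw [Complex.exp_eq_one_iff]; exact ⟨m, by ring⟩
    simp [this]

open Complex in
theorem intervalIntegral_norm_sq_trigPoly (s : Finset ℤ) (x : ℤ → ℂ) :
    ∫ t in (0 : ℝ)..1, ‖∑ j ∈ s, x j * Complex.exp (2 * Real.pi * I * j * t)‖ ^ 2
      = ∑ j ∈ s, ‖x j‖ ^ 2 := by
  have h1 : ∀ t : ℝ, ((‖∑ j ∈ s, x j * Complex.exp (2 * Real.pi * I * j * t)‖ ^ 2 : ℝ) : ℂ)
      = ∑ j ∈ s, ∑ k ∈ s, x j * starRingEnd ℂ (x k) *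
        Complex.exp (2 * Real.pi * I * (j - k : ℤ) * t) := by
    intro t
    rw [← Complex.normSq_eq_norm_sq, ← Complex.mul_conj, map_sum, Finset.sum_mul_sum]
    refine Finset.sum_congr rfl fun j _ => Finset.sum_congr rfl fun k _ => ?_
    rw [map_mul, ← Complex.exp_conj]
    simp only [map_mul, Complex.conj_ofReal, Complex.conj_I, map_ofNat, map_intCast]
    rw [mul_mul_mul_comm, ← Complex.exp_add]
    congr 2
    push_cast; ring
  have h2 : ((∫ t in (0 : ℝ)..1, ‖∑ j ∈ s, x j * Complex.exp (2 * Real.pi * I * j * t)‖ ^ 2 : ℝ)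
      : ℂ) = ((∑ j ∈ s, ‖x j‖ ^ 2 : ℝ) : ℂ) := by
    rw [← intervalIntegral.integral_ofReal]
    simp_rw [h1]
    rw [intervalIntegral.integral_finsetSum fun j _ =>
      Continuous.intervalIntegrable (by fun_prop) _ _]
    rw [Complex.ofReal_sum]
    refine Finset.sum_congr rfl fun j hj => ?_
    rw [intervalIntegral.integral_finsetSum fun j _ =>
      Continuous.intervalIntegrable (by fun_prop) _ _]
    simp_rw [intervalIntegral.integral_const_mul, intervalIntegral_exp_int, sub_eq_zero]
    simp [hj, Complex.mul_conj, Complex.normSq_eq_norm_sq]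
  exact_mod_cast h2

-- Up to the factor `-2πi`, the numbers `1 / m` are the Fourier coefficients of the sawtooth `t -
-- 1/2`. Its mean is zero, which agrees with `1 / 0 = 0`.
open Complex in
theorem inv_int_eq_intervalIntegral (m : ℤ) :
    (1 / m : ℂ) = -(2 * Real.pi * I) *
      ∫ t in (0 : ℝ)..1, ((t - 1 / 2 : ℝ) : ℂ) * Complex.exp (2 * Real.pi * I * (-m : ℤ) * t) := by
  have h := bernoulliFourierCoeff_eq one_ne_zero m
  rw [bernoulliFourierCoeff, fourierCoeffOn_eq_integral] at h
  have e : ∫ t in (0 : ℝ)..1, ((t - 1 / 2 : ℝ) : ℂ) *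
      Complex.exp (2 * Real.pi * I * (-m : ℤ) * t) = -1 / (2 * Real.pi * I * m) := by
    have h' := h
    simp only [sub_zero, div_one, one_smul, pow_one, Nat.factorial_one,
      Nat.cast_one] at h'
    rw [← h']
    refine intervalIntegral.integral_congr fun t _ => ?_
    simp only [bernoulliFun_one, fourier_coe_apply, sub_zero]
    rw [mul_comm]
    congr 2
    simp
  rw [e]
  rcases eq_or_ne m 0 with rfl | hm
  · simp
  · have : (m : ℂ) ≠ 0 := by exact_mod_cast hm
    have := Real.pi_ne_zero
    field_simp

open Complex in
/-- Hilbert's inequality. -/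
theorem bilinearBound_hilbert :
    BilinearBound (fun j k : ℤ => (1 / (j - k : ℤ) : ℂ)) Real.pi := by
  intro s x y
  set P : ℝ → ℂ := fun t => ∑ j ∈ s, x j * Complex.exp (2 * Real.pi * I * (-j : ℤ) * t) with hP
  set Q : ℝ → ℂ := fun t => ∑ j ∈ s, y j * Complex.exp (2 * Real.pi * I * j * t) with hQ
  have hPc : Continuous P := by fun_prop
  have hQc : Continuous Q := by fun_prop
  -- The sawtooth formula separates `j` from `k`. The prefactor `2π` times the bound `1/2` for `|t -
  -- 1/2|` gives the constant `π`.
  have e : ∑ j ∈ s, ∑ k ∈ s, x j * (1 / (j - k : ℤ) : ℂ) * y k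
      = -(2 * Real.pi * I) * ∫ t in (0 : ℝ)..1, ((t - 1 / 2 : ℝ) : ℂ) * (P t * Q t) := by
    have h1 : ∀ t : ℝ, ((t - 1 / 2 : ℝ) : ℂ) * (P t * Q t) = ∑ j ∈ s, ∑ k ∈ s, (x j * y k) *
        (((t - 1 / 2 : ℝ) : ℂ) * Complex.exp (2 * Real.pi * I * (-(j - k) : ℤ) * t)) := by
      intro t
      simp only [hP, hQ]
      rw [Finset.sum_mul_sum, Finset.mul_sum]
      simp_rw [Finset.mul_sum]
      refine Finset.sum_congr rfl fun j _ => Finset.sum_congr rfl fun k _ => ?_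
      rw [mul_mul_mul_comm, ← Complex.exp_add]
      rw [mul_left_comm]
      congr 3
      push_cast; ring
    simp_rw [h1]
    rw [intervalIntegral.integral_finsetSum fun j _ =>
      Continuous.intervalIntegrable (by fun_prop) _ _, Finset.mul_sum]
    refine Finset.sum_congr rfl fun j hj => ?_
    rw [intervalIntegral.integral_finsetSum fun j _ =>
      Continuous.intervalIntegrable (by fun_prop) _ _, Finset.mul_sum]
    refine Finset.sum_congr rfl fun k hk => ?_
    rw [inv_int_eq_intervalIntegral, intervalIntegral.integral_const_mul]
    ring
  have hPn : ∫ t in (0 : ℝ)..1, ‖P t‖ ^ 2 = ∑ j ∈ s, ‖x j‖ ^ 2 := by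
    have := intervalIntegral_norm_sq_trigPoly (s.map (Equiv.neg ℤ).toEmbedding) (fun j => x (-j))
    simpa [Finset.sum_map, hP] using this
  have hQn : ∫ t in (0 : ℝ)..1, ‖Q t‖ ^ 2 = ∑ j ∈ s, ‖y j‖ ^ 2 :=
    intervalIntegral_norm_sq_trigPoly s y
  have hCS : ∫ t in (0 : ℝ)..1, ‖P t‖ * ‖Q t‖ ≤
      √(∑ j ∈ s, ‖x j‖ ^ 2) * √(∑ k ∈ s, ‖y k‖ ^ 2) := by
    have hm : ∀ R : ℝ → ℂ, Continuous R →
        MemLp (fun t => ‖R t‖) (ENNReal.ofReal 2) (volume.restrict (Set.Ioc (0 : ℝ) 1)) := by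
      intro R hR
      obtain ⟨c, hc⟩ := (isCompact_Icc (a := (0 : ℝ)) (b := 1)).exists_bound_of_continuousOn
        hR.continuousOn
      refine MemLp.of_bound hR.norm.aestronglyMeasurable c ?_
      refine (ae_restrict_mem measurableSet_Ioc).mono fun t ht => ?_
      simpa using hc t (Set.Ioc_subset_Icc_self ht)
    have := integral_mul_le_Lp_mul_Lq_of_nonneg Real.HolderConjugate.two_two
      (μ := volume.restrict (Set.Ioc (0 : ℝ) 1))
      (Eventually.of_forall fun t => norm_nonneg (P t))
      (Eventually.of_forall fun t => norm_nonneg (Q t)) (hm P hPc) (hm Q hQc)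
    rw [intervalIntegral.integral_of_le zero_le_one] at hPn hQn ⊢
    simp only [Real.rpow_two, hPn, hQn, ← Real.sqrt_eq_rpow] at this
    exact this
  have hbd : ‖∫ t in (0 : ℝ)..1, ((t - 1 / 2 : ℝ) : ℂ) * (P t * Q t)‖ ≤
      1 / 2 * ∫ t in (0 : ℝ)..1, ‖P t‖ * ‖Q t‖ := by
    rw [← intervalIntegral.integral_const_mul]
    refine intervalIntegral.norm_integral_le_of_norm_le zero_le_one ?_
      (Continuous.intervalIntegrable (by fun_prop) _ _)
    refine Eventually.of_forall fun t ht => ?_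
    rw [norm_mul, norm_mul, Complex.norm_real]
    gcongr
    rw [Real.norm_eq_abs, abs_le]
    constructor <;> linarith [ht.1, ht.2]
  rw [e, norm_mul]
  have : ‖-(2 * Real.pi * I)‖ = 2 * Real.pi := by
    simp [abs_of_pos Real.pi_pos]
  rw [this]
  calc 2 * Real.pi * _ ≤ 2 * Real.pi * (1 / 2 * (√(∑ j ∈ s, ‖x j‖ ^ 2) * √(∑ k ∈ s, ‖y k‖ ^ 2))) := by
        gcongr
        exact hbd.trans (by gcongr)
    _ = _ := by ring

/-! ## Divided differences of functions of one variable -/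

/-- The divided difference of a function on the real line. -/
def lineDiff (φ : ℝ → ℂ) (x₁ x₂ : ℝ) : ℂ :=
  if x₁ = x₂ then deriv φ x₁ else (φ x₁ - φ x₂) / ((x₁ - x₂ : ℝ) : ℂ)

/-- Off the diagonal the matrix is the Hilbert matrix with rows multiplied by `φ j`, minus the same
with columns multiplied by `φ k`. Both vanish on the diagonal because `1 / 0 = 0`, so the
derivatives are added there as a diagonal matrix. -/
theorem bilinearBound_lineDiff {φ : ℝ → ℂ} {A D : ℝ} (hA : ∀ t, ‖φ t‖ ≤ A)
    (hD : ∀ t, ‖deriv φ t‖ ≤ D) :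
    BilinearBound (fun j k : ℤ => lineDiff φ j k) (2 * A * Real.pi + D) := by
  have hA0 : 0 ≤ A := (norm_nonneg _).trans (hA 0)
  have hD0 : 0 ≤ D := (norm_nonneg _).trans (hD 0)
  have h1 := bilinearBound_hilbert.left_mul Real.pi_pos.le (fun j : ℤ => φ j) hA0 fun j => hA j
  have h2 := (bilinearBound_hilbert.right_mul Real.pi_pos.le (fun j : ℤ => φ j) hA0
    fun j => hA j).const_mul (-1)
  have h3 := BilinearBound.diagonal (fun j : ℤ => deriv φ j) hD0 fun j => hD j
  have := ((h1.add h2).add h3).mono (C' := 2 * A * Real.pi + D) (by simp; linarith)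
  convert this using 3 with j k
  rcases eq_or_ne j k with rfl | h
  · simp [lineDiff]
  · have : (j : ℝ) ≠ k := by exact_mod_cast h
    simp only [lineDiff, this, h, if_false]
    push_cast
    ring

end

noncomputable section

/-! ## A sampling kernel -/

open scoped FourierTransform

/-- A smooth bump which is `1` on `[-1/4, 1/4]` and vanishes outside `(-1/2, 1/2)`. -/
def samplingBump : ContDiffBump (0 : ℝ) where
  rIn := 1 / 4
  rOut := 1 / 2
  rIn_pos := by norm_num
  rIn_lt_rOut := by norm_num

theorem hasCompactSupport_samplingBump_mul (u : ℝ → ℂ) :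
    HasCompactSupport fun t => (samplingBump t : ℂ) * u t :=
  HasCompactSupport.mul_right (samplingBump.hasCompactSupport.comp_left Complex.ofReal_zero)

/-- The function `t ↦ κ(t) e^{2πitx}`, where `κ` is the bump used for sampling. -/
def modulatedBump (x : ℝ) : 𝓢(ℝ, ℂ) :=
  (hasCompactSupport_samplingBump_mul fun t =>
    Complex.exp (2 * Real.pi * Complex.I * x * t)).toSchwartzMap ((Complex.ofRealCLM.contDiff.comp samplingBump.contDiff).mul
      (Complex.contDiff_exp.comp (contDiff_const.mul Complex.ofRealCLM.contDiff)))

/-- A rapidly decreasing kernel that reproduces band-limited functions from their values at the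
integers. -/
def samplingKernel (x : ℝ) : ℂ := 𝓕 (modulatedBump 0) (-x)

theorem modulatedBump_apply (x t : ℝ) : modulatedBump x t =
    (samplingBump t : ℂ) * Complex.exp (2 * Real.pi * Complex.I * x * t) := rfl

theorem continuous_samplingKernel : Continuous samplingKernel :=
  (𝓕 (modulatedBump 0)).continuous.comp continuous_neg

theorem fourier_modulatedBump (x y : ℝ) :
    𝓕 (modulatedBump x) y = samplingKernel (x - y) := by
  simp only [samplingKernel, SchwartzMap.fourier_coe, Real.fourier_real_eq_integral_exp_smul,
    modulatedBump_apply, smul_eq_mul]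
  congr 1
  ext t
  rw [mul_left_comm, mul_left_comm (Complex.exp (_ * Complex.I)), ← Complex.exp_add,
    ← Complex.exp_add]
  congr 2
  push_cast; ring

theorem exists_samplingKernel_decay :
    ∃ A : ℝ, 0 < A ∧ ∀ x, ‖samplingKernel x‖ ≤ A / (1 + x ^ 2) := by
  obtain ⟨C₀, h0, hC₀⟩ := (𝓕 (modulatedBump 0)).decay 0 0
  obtain ⟨C₂, h2, hC₂⟩ := (𝓕 (modulatedBump 0)).decay 2 0
  refine ⟨C₀ + C₂, by positivity, fun x => ?_⟩
  rw [le_div_iff₀ (by positivity)]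
  have h1 := hC₀ (-x)
  have h3 := hC₂ (-x)
  simp only [pow_zero, one_mul, norm_iteratedFDeriv_zero, norm_neg, Real.norm_eq_abs, sq_abs]
    at h1 h3
  unfold samplingKernel
  linarith

/-- The sum is periodic in `x` with period `1`, so only `x ∈ [0, 1)` matters, where decay gives a
summable majorant independent of `x`. -/
theorem exists_tsum_samplingKernel_le : ∃ B : ℝ, 0 < B ∧
    ∀ x : ℝ, Summable (fun j : ℤ => ‖samplingKernel (x - j)‖) ∧
      ∑' j : ℤ, ‖samplingKernel (x - j)‖ ≤ B := by
  obtain ⟨A, hA, hK⟩ := exists_samplingKernel_decay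
  have hs : Summable fun j : ℤ => 1 / (1 + (j : ℝ) ^ 2) := by
    have h := (Real.summable_one_div_int_pow (p := 2)).2 one_lt_two
    refine Summable.of_norm_bounded_eventually h ?_
    refine (Set.finite_singleton (0 : ℤ)).subset fun j hj => ?_
    by_contra h0
    refine hj ?_
    have : (0 : ℝ) < (j : ℝ) ^ 2 := by
      have : (j : ℝ) ≠ 0 := by exact_mod_cast h0
      positivity
    change ‖1 / (1 + (j : ℝ) ^ 2)‖ ≤ 1 / (j : ℝ) ^ 2
    rw [Real.norm_of_nonneg (by positivity)]
    gcongr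
    linarith
  -- The factor `3` comes from `1 + j² ≤ 3 (1 + (t - j)²)` for `0 ≤ t < 1`.
  have hb : ∀ (t : ℝ), 0 ≤ t → t < 1 → ∀ j : ℤ,
      ‖samplingKernel (t - j)‖ ≤ 3 * A * (1 / (1 + (j : ℝ) ^ 2)) := by
    intro t h0 h1 j
    refine (hK _).trans ?_
    rw [mul_one_div, div_le_div_iff₀ (by positivity) (by positivity)]
    nlinarith [sq_nonneg ((j : ℝ) - 2 * t), mul_nonneg hA.le (sq_nonneg ((j : ℝ) - 2 * t)),
      mul_nonneg hA.le (sq_nonneg (2 * (j : ℝ) - 3 * t)), mul_nonneg hA.le h0,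
      mul_le_mul_of_nonneg_left (show t ^ 2 ≤ 1 by nlinarith) hA.le]
  set S := ∑' j : ℤ, 3 * A * (1 / (1 + (j : ℝ) ^ 2))
  have hS0 : 0 ≤ S := tsum_nonneg fun j => by positivity
  have hfr : ∀ x : ℝ, Summable (fun j : ℤ => ‖samplingKernel (Int.fract x - j)‖) ∧
      ∑' j : ℤ, ‖samplingKernel (Int.fract x - j)‖ ≤ S := by
    intro x
    have h := hb _ (Int.fract_nonneg x) (Int.fract_lt_one x)
    have h1 := Summable.of_nonneg_of_le (fun j => norm_nonneg _) h (hs.mul_left _)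
    exact ⟨h1, h1.tsum_le_tsum h (hs.mul_left _)⟩
  refine ⟨S + 1, by positivity, fun x => ?_⟩
  have e : (fun j : ℤ => ‖samplingKernel (x - j)‖) =
      (fun j : ℤ => ‖samplingKernel (Int.fract x - j)‖) ∘ (Equiv.subRight ⌊x⌋) := by
    ext j
    simp only [Function.comp, Equiv.subRight_apply, Int.cast_sub, Int.fract]
    congr 2
    ring
  rw [e]
  refine ⟨(Equiv.summable_iff _).2 (hfr x).1, ?_⟩
  rw [show ∑' j : ℤ, ((fun j : ℤ => ‖samplingKernel (Int.fract x - j)‖) ∘ (Equiv.subRight ⌊x⌋)) j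
    = _ from (Equiv.subRight ⌊x⌋).tsum_eq fun j : ℤ => ‖samplingKernel (Int.fract x - j)‖]
  linarith [(hfr x).2]

/-- An upper bound of `∑_j |K(x - j)|`, where `K` is the sampling kernel. -/
def samplingBound : ℝ := exists_tsum_samplingKernel_le.choose

theorem samplingBound_pos : 0 < samplingBound := exists_tsum_samplingKernel_le.choose_spec.1

theorem summable_norm_samplingKernel (x : ℝ) :
    Summable fun j : ℤ => ‖samplingKernel (x - j)‖ :=
  (exists_tsum_samplingKernel_le.choose_spec.2 x).1

theorem tsum_norm_samplingKernel_le (x : ℝ) :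
    ∑' j : ℤ, ‖samplingKernel (x - j)‖ ≤ samplingBound :=
  (exists_tsum_samplingKernel_le.choose_spec.2 x).2

theorem norm_samplingKernel_le (x : ℝ) : ‖samplingKernel x‖ ≤ samplingBound := by
  have := (summable_norm_samplingKernel x).le_tsum 0 fun _ _ => norm_nonneg _
  simp only [Int.cast_zero, sub_zero] at this
  exact this.trans (tsum_norm_samplingKernel_le x)

/-- Sampling of exponentials at the integers. -/
theorem hasSum_samplingKernel_exp (x : ℝ) {t : ℝ} (ht : |t| ≤ 1 / 4) :
    HasSum (fun j : ℤ => samplingKernel (x - j) * Complex.exp (2 * Real.pi * Complex.I * j * t))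
      (Complex.exp (2 * Real.pi * Complex.I * x * t)) := by
  -- Poisson summation. As `|t| ≤ 1/4`, the points `t + n` with `n ≠ 0` lie outside the support of
  -- the bump, and the bump is `1` at `t`.
  have h := SchwartzMap.tsum_eq_tsum_fourier (modulatedBump x) t
  have h1 : ∑' n : ℤ, modulatedBump x (t + n) =
      Complex.exp (2 * Real.pi * Complex.I * x * t) := by
    rw [tsum_eq_single 0]
    · have : samplingBump t = 1 := by
        refine samplingBump.one_of_mem_closedBall ?_
        simpa [samplingBump] using ht
      simp [modulatedBump_apply, this]
    · intro n hn
      have : samplingBump (t + n) = 0 := by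
        refine samplingBump.zero_of_le_dist ?_
        rw [Real.dist_eq, sub_zero]
        have h1 : (1 : ℝ) ≤ |(n : ℝ)| := by exact_mod_cast Int.one_le_abs hn
        have h2 : |(n : ℝ)| ≤ |t + n| + |t| := by
          have := abs_sub (t + n) t
          simpa using this
        change (1 / 2 : ℝ) ≤ _
        linarith
      simp [modulatedBump_apply, this]
  have h2 : ∀ j : ℤ, 𝓕 (modulatedBump x) (j : ℝ) * fourier j (t : UnitAddCircle) =
      samplingKernel (x - j) * Complex.exp (2 * Real.pi * Complex.I * j * t) := by
    intro j
    rw [fourier_modulatedBump, fourier_coe_apply]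
    simp
  rw [h1] at h
  simp_rw [h2] at h
  rw [h]
  refine Summable.hasSum (Summable.of_norm_bounded (summable_norm_samplingKernel x) fun j => ?_)
  rw [norm_mul]
  have : ‖Complex.exp (2 * Real.pi * Complex.I * j * t)‖ = 1 := by
    have := Complex.norm_exp_ofReal_mul_I (2 * Real.pi * j * t)
    rw [← this]; congr 2; push_cast; ring
  rw [this, mul_one]

/-! ## Sampling of divided differences -/

/-- The restrictions of `h` to arithmetic progressions of step at most `1` determine `h` through the
sampling formula. -/
def IsSampled (h : ℝ → ℂ) : Prop :=
  ∀ a ∈ Set.Icc (0 : ℝ) 1, ∀ b x : ℝ,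
    HasSum (fun j : ℤ => samplingKernel (x - j) * h (a * j + b)) (h (a * x + b))

/-- The integral has no singular denominator and treats the diagonal like every other point. -/
theorem lineDiff_eq_integral {φ φ' : ℝ → ℂ} (hd : ∀ t, HasDerivAt φ (φ' t) t)
    (hc : Continuous φ') (x₁ x₂ : ℝ) :
    lineDiff φ x₁ x₂ = ∫ s in Set.Ioc (0 : ℝ) 1, φ' (s * x₁ + (1 - s) * x₂) := by
  rw [← intervalIntegral.integral_of_le zero_le_one]
  rcases eq_or_ne x₁ x₂ with rfl | h
  · have : ∀ s : ℝ, s * x₁ + (1 - s) * x₁ = x₁ := fun s => by ring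
    simp [lineDiff, this, (hd x₁).deriv]
  · have hder : ∀ s ∈ Set.uIcc (0 : ℝ) 1, HasDerivAt (fun s : ℝ => φ (s * x₁ + (1 - s) * x₂))
        (((x₁ - x₂ : ℝ) : ℂ) * φ' (s * x₁ + (1 - s) * x₂)) s := by
      intro s _
      have h1 : HasDerivAt (fun s : ℝ => s * x₁ + (1 - s) * x₂) (x₁ - x₂) s := by
        have e : (fun s : ℝ => s * x₁ + (1 - s) * x₂) = fun s => s * (x₁ - x₂) + x₂ := by
          ext s; ring
        rw [e]
        simpa using ((hasDerivAt_id s).mul_const (x₁ - x₂)).add_const x₂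
      have := (hd (s * x₁ + (1 - s) * x₂)).scomp s h1
      rwa [Complex.real_smul] at this
    have hI := intervalIntegral.integral_eq_sub_of_hasDerivAt hder
      (Continuous.intervalIntegrable (by fun_prop) _ _)
    rw [intervalIntegral.integral_const_mul] at hI
    have hne : ((x₁ - x₂ : ℝ) : ℂ) ≠ 0 := by
      exact_mod_cast sub_ne_zero.2 h
    simp only [lineDiff, h, if_false]
    rw [div_eq_iff hne, mul_comm, hI]
    simp

theorem norm_lineDiff_le {φ φ' : ℝ → ℂ} (hd : ∀ t, HasDerivAt φ (φ' t) t)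
    (hc : Continuous φ') {D : ℝ} (hD : ∀ t, ‖φ' t‖ ≤ D) (x₁ x₂ : ℝ) :
    ‖lineDiff φ x₁ x₂‖ ≤ D := by
  rw [lineDiff_eq_integral hd hc, ← intervalIntegral.integral_of_le zero_le_one]
  simpa using intervalIntegral.norm_integral_le_of_norm_le_const (a := 0) (b := 1)
    (f := fun s => φ' (s * x₁ + (1 - s) * x₂)) fun s _ => hD _

theorem summable_samplingKernel_mul (x₁ x₂ : ℝ) :
    Summable fun p : ℤ × ℤ => ‖samplingKernel (x₁ - p.1)‖ * ‖samplingKernel (x₂ - p.2)‖ :=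
  (summable_norm_samplingKernel x₁).mul_of_nonneg (summable_norm_samplingKernel x₂)
    (fun _ => norm_nonneg _) fun _ => norm_nonneg _

/-- Under the integral, `φ'` is sampled in `x₂` with step `1 - s` and in `x₁` with step `s`; both
steps lie in `[0, 1]`, as `IsSampled` requires. Absolute summability of the kernels justifies the
double sum and the integration over `s`. -/
theorem hasSum_lineDiff {φ φ' : ℝ → ℂ} (hd : ∀ t, HasDerivAt φ (φ' t) t)
    (hc : Continuous φ') {D : ℝ} (hD : ∀ t, ‖φ' t‖ ≤ D) (hs : IsSampled φ') (x₁ x₂ : ℝ) :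
    HasSum (fun p : ℤ × ℤ => samplingKernel (x₁ - p.1) * samplingKernel (x₂ - p.2) *
      lineDiff φ p.1 p.2) (lineDiff φ x₁ x₂) := by
  have hD0 : 0 ≤ D := (norm_nonneg _).trans (hD 0)
  have hsum : ∀ u : ℤ × ℤ → ℂ, (∀ p, ‖u p‖ ≤ D) → Summable fun p : ℤ × ℤ =>
      samplingKernel (x₁ - p.1) * samplingKernel (x₂ - p.2) * u p := by
    intro u hu
    refine Summable.of_norm_bounded ((summable_samplingKernel_mul x₁ x₂).mul_right D) fun p => ?_
    rw [norm_mul, norm_mul]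
    gcongr
    exact hu p
  have hpt : ∀ s ∈ Set.Ioc (0 : ℝ) 1, HasSum (fun p : ℤ × ℤ =>
      samplingKernel (x₁ - p.1) * samplingKernel (x₂ - p.2) *
        φ' (s * (p.1 : ℝ) + (1 - s) * (p.2 : ℝ))) (φ' (s * x₁ + (1 - s) * x₂)) := by
    intro s hs'
    have h := (hsum (fun p => φ' (s * (p.1 : ℝ) + (1 - s) * (p.2 : ℝ))) fun p => hD _).hasSum
    have hfib : ∀ j : ℤ, HasSum (fun k : ℤ => samplingKernel (x₁ - j) * samplingKernel (x₂ - k) *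
        φ' (s * (j : ℝ) + (1 - s) * (k : ℝ)))
        (samplingKernel (x₁ - j) * φ' (s * (j : ℝ) + (1 - s) * x₂)) := by
      intro j
      have := (hs (1 - s) ⟨by linarith [hs'.2], by linarith [hs'.1]⟩ (s * j) x₂).mul_left
        (samplingKernel (x₁ - j))
      simp_rw [← mul_assoc] at this
      simpa only [add_comm (s * (j : ℝ))] using this
    have h2 := h.prod_fiberwise hfib
    have h3 := hs s ⟨hs'.1.le, hs'.2⟩ ((1 - s) * x₂) x₁
    rwa [h2.unique h3] at h
  rw [lineDiff_eq_integral hd hc]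
  have hF : ∀ p : ℤ × ℤ, Integrable (fun s : ℝ => samplingKernel (x₁ - p.1) *
      samplingKernel (x₂ - p.2) * φ' (s * (p.1 : ℝ) + (1 - s) * (p.2 : ℝ)))
      (volume.restrict (Set.Ioc (0 : ℝ) 1)) := by
    intro p
    have : Continuous fun s : ℝ => samplingKernel (x₁ - p.1) *
      samplingKernel (x₂ - p.2) * φ' (s * (p.1 : ℝ) + (1 - s) * (p.2 : ℝ)) := by fun_prop
    exact (this.integrableOn_Icc).mono_set Set.Ioc_subset_Icc_self
  have := hasSum_integral_of_summable_integral_norm hF (by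
    refine Summable.of_nonneg_of_le (fun p => integral_nonneg fun _ => norm_nonneg _) (fun p => ?_)
      ((summable_samplingKernel_mul x₁ x₂).mul_right D)
    refine (integral_mono_of_nonneg (Eventually.of_forall fun _ => norm_nonneg _)
      (integrable_const (‖samplingKernel (x₁ - p.1)‖ * ‖samplingKernel (x₂ - p.2)‖ * D))
      (Eventually.of_forall fun s => ?_)).trans (by simp)
    simp only [norm_mul]
    gcongr
    exact hD _)
  rw [setIntegral_congr_fun measurableSet_Ioc fun s hs' => (hpt s hs').tsum_eq] at this
  simp_rw [integral_const_mul] at this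
  simpa only [lineDiff_eq_integral hd hc] using this

/-! ## Haagerup-type representations from sampled pieces -/

theorem summable_scaled_samplingKernel {M ρ : ℤ → ℝ} (hM : ∀ n, 0 ≤ M n) (hMs : Summable M)
    (x₁ x₂ : ℝ) : Summable fun q : ℤ × (ℤ × ℤ) => M q.1 *
      (‖samplingKernel (ρ q.1 * x₁ - q.2.1)‖ * ‖samplingKernel (ρ q.1 * x₂ - q.2.2)‖) := by
  rw [summable_prod_of_nonneg fun q =>
    mul_nonneg (hM q.1) (mul_nonneg (norm_nonneg _) (norm_nonneg _))]
  refine ⟨fun n => (summable_samplingKernel_mul (ρ n * x₁) (ρ n * x₂)).mul_left (M n), ?_⟩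
  refine Summable.of_nonneg_of_le (fun n => tsum_nonneg fun q =>
    mul_nonneg (hM n) (mul_nonneg (norm_nonneg _) (norm_nonneg _))) (fun n => ?_)
    (hMs.mul_right (samplingBound * samplingBound))
  have h := (summable_norm_samplingKernel (ρ n * x₁)).tsum_mul_tsum
    (summable_norm_samplingKernel (ρ n * x₂)) (summable_samplingKernel_mul (ρ n * x₁) (ρ n * x₂))
  have h2 := mul_le_mul (tsum_norm_samplingKernel_le (ρ n * x₁))
    (tsum_norm_samplingKernel_le (ρ n * x₂)) (tsum_nonneg fun _ => norm_nonneg _)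
    samplingBound_pos.le
  rw [h] at h2
  refine le_trans (le_of_eq ?_) (mul_le_mul_of_nonneg_left h2 (hM n))
  exact tsum_mul_left (a := M n) (L := SummationFilter.unconditional (ℤ × ℤ)) (f := fun q =>
    ‖samplingKernel (ρ n * x₁ - q.1)‖ * ‖samplingKernel (ρ n * x₂ - q.2)‖)

/-- The summation index is a pair (scale `n`, sample point `j`). The same vectors serve both
variables, and a matrix that is block diagonal in the scale couples them. -/
theorem exists_haagerup_representation {M ρ : ℤ → ℝ} (hM : ∀ n, 0 ≤ M n) (hMs : Summable M)
    {γ : ℤ → ℤ → ℤ → ℝ → ℂ} {A : ℝ} (hA : 0 ≤ A) (hγm : ∀ n j k, Measurable (γ n j k))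
    (hγA : ∀ n j k y, ‖γ n j k y‖ ≤ A) (hγ : ∀ n y, BilinearBound (fun j k => γ n j k y) A)
    {d : ℤ → ℝ → ℝ → ℝ → ℂ} (hd : ∀ n x₁ x₂ y, HasSum (fun p : ℤ × ℤ =>
      samplingKernel (ρ n * x₁ - p.1) * samplingKernel (ρ n * x₂ - p.2) * γ n p.1 p.2 y)
      (d n x₁ x₂ y))
    {Ψ : ℝ → ℝ → ℝ → ℂ} (hΨ : ∀ x₁ x₂ y, HasSum (fun n => (M n : ℂ) * d n x₁ x₂ y) (Ψ x₁ x₂ y)) :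
    ∃ (α : ℕ → ℝ → ℂ) (g : ℕ → ℕ → ℝ → ℂ), (∀ j, Measurable (α j)) ∧ (∀ j k, Measurable (g j k)) ∧
      (∀ x, ell2Norm (fun j => α j x) ≤
        (ENNReal.ofReal (samplingBound ^ 2) * ∑' n, ENNReal.ofReal (M n)) ^ (1 / 2 : ℝ)) ∧
      (∀ y, matrixNorm (fun j k => g j k y) ≤ ENNReal.ofReal A) ∧
      ∀ x₁ x₂ y, Tendsto (fun p : ℕ × ℕ => ∑ j ∈ Finset.range p.1, ∑ k ∈ Finset.range p.2,
        α j x₁ * α k x₂ * g j k y) atTop (𝓝 (Ψ x₁ x₂ y)) := by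
  let e : ℕ ≃ ℤ × ℤ := (Denumerable.eqv (ℤ × ℤ)).symm
  -- Each of the two vectors carries half of the weight `M n`, so each squared `ℓ²` norm is bounded
  -- by a multiple of `∑ M n`.
  let a : ℤ × ℤ → ℝ → ℂ := fun p x => (√(M p.1) : ℂ) * samplingKernel (ρ p.1 * x - p.2)
  let b : ℤ × ℤ → ℤ × ℤ → ℝ → ℂ := fun p q y => if p.1 = q.1 then γ p.1 p.2 q.2 y else 0
  refine ⟨fun i => a (e i), fun i k => b (e i) (e k), fun i => ?_, fun i k => ?_, fun x => ?_,
    fun y => ?_, fun x₁ x₂ y => ?_⟩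
  · exact (continuous_const.mul (continuous_samplingKernel.comp (by fun_prop))).measurable
  · simp only [b]
    split_ifs
    exacts [hγm _ _ _, measurable_const]
  · unfold ell2Norm
    refine ENNReal.rpow_le_rpow ?_ (by norm_num)
    rw [e.tsum_eq fun p => ‖a p x‖ₑ ^ 2, ENNReal.tsum_prod', ← ENNReal.tsum_mul_left]
    refine ENNReal.tsum_le_tsum fun n => ?_
    have hK : ∀ t, ‖samplingKernel t‖ₑ ≤ ENNReal.ofReal samplingBound := fun t => by
      rw [← ofReal_norm]; exact ENNReal.ofReal_le_ofReal (norm_samplingKernel_le t)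
    have hKs : ∀ t : ℝ, ∑' j : ℤ, ‖samplingKernel (t - j)‖ₑ ≤ ENNReal.ofReal samplingBound := by
      intro t
      simp_rw [← ofReal_norm]
      rw [← ENNReal.ofReal_tsum_of_nonneg (fun _ => norm_nonneg _) (summable_norm_samplingKernel t)]
      exact ENNReal.ofReal_le_ofReal (tsum_norm_samplingKernel_le t)
    have hsq : ‖(√(M n) : ℂ)‖ₑ ^ 2 = ENNReal.ofReal (M n) := by
      rw [← ofReal_norm, ← ENNReal.ofReal_pow (norm_nonneg _), Complex.norm_real,
        Real.norm_of_nonneg (Real.sqrt_nonneg _), Real.sq_sqrt (hM n)]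
    simp only [a, enorm_mul, mul_pow, hsq]
    rw [ENNReal.tsum_mul_left, mul_comm]
    gcongr
    -- `∑ |K|² ≤ sup |K| · ∑ |K|`, and both factors are at most `samplingBound`.
    calc ∑' j : ℤ, ‖samplingKernel (ρ n * x - j)‖ₑ ^ 2
        ≤ ∑' j : ℤ, ENNReal.ofReal samplingBound * ‖samplingKernel (ρ n * x - j)‖ₑ :=
          ENNReal.tsum_le_tsum fun j => by rw [sq]; gcongr; exact hK _
      _ ≤ ENNReal.ofReal (samplingBound ^ 2) := by
          rw [ENNReal.tsum_mul_left, ENNReal.ofReal_pow samplingBound_pos.le, sq]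
          gcongr
          exact hKs _
  · exact ((BilinearBound.blockDiagonal (fun n j k => γ n j k y) hA fun n => hγ n y).reindex
      e).matrixNorm_le hA
  · have hterm : ∀ q : ℤ × (ℤ × ℤ), a (q.1, q.2.1) x₁ * a (q.1, q.2.2) x₂ * γ q.1 q.2.1 q.2.2 y =
        (M q.1 : ℂ) * (samplingKernel (ρ q.1 * x₁ - q.2.1) * samplingKernel (ρ q.1 * x₂ - q.2.2) *
          γ q.1 q.2.1 q.2.2 y) := by
      intro q
      have : (√(M q.1) : ℂ) * √(M q.1) = M q.1 := by
        rw [← Complex.ofReal_mul, Real.mul_self_sqrt (hM _)]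
      simp only [a]
      rw [← this]
      ring
    have hsum : Summable fun q : ℤ × (ℤ × ℤ) =>
        a (q.1, q.2.1) x₁ * a (q.1, q.2.2) x₂ * γ q.1 q.2.1 q.2.2 y := by
      have hm := (summable_scaled_samplingKernel (ρ := ρ) hM hMs x₁ x₂).mul_right A
      refine Summable.of_norm_bounded hm fun q => ?_
      rw [hterm, norm_mul, norm_mul, norm_mul, Complex.norm_real, Real.norm_of_nonneg (hM _)]
      rw [← mul_assoc]
      exact mul_le_mul_of_nonneg_left (hγA _ _ _ _)
        (mul_nonneg (hM _) (mul_nonneg (norm_nonneg _) (norm_nonneg _)))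
    have h1 : HasSum (fun q : ℤ × (ℤ × ℤ) =>
        a (q.1, q.2.1) x₁ * a (q.1, q.2.2) x₂ * γ q.1 q.2.1 q.2.2 y) (Ψ x₁ x₂ y) := by
      have h := hsum.hasSum
      have h2 := h.prod_fiberwise (g := fun n => (M n : ℂ) * d n x₁ x₂ y) fun n => by
        rw [funext fun q => hterm (n, q)]
        exact (hd n x₁ x₂ y).mul_left (M n : ℂ)
      rwa [h2.unique (hΨ x₁ x₂ y)] at h
    have h2 : HasSum (fun r : (ℤ × ℤ) × (ℤ × ℤ) => a r.1 x₁ * a r.2 x₂ * b r.1 r.2 y)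
        (Ψ x₁ x₂ y) := by
      -- Pairs of indices of different scales contribute zero, so the triple sum over `(n, j, k)` is
      -- the full double sum.
      let ι : ℤ × (ℤ × ℤ) → (ℤ × ℤ) × (ℤ × ℤ) := fun q => ((q.1, q.2.1), (q.1, q.2.2))
      have hι : Function.Injective ι := by
        rintro ⟨n, j, k⟩ ⟨n', j', k'⟩ h
        simp only [ι, Prod.mk.injEq] at h ⊢
        tauto
      refine (hι.hasSum_iff ?_).1 ?_
      · rintro ⟨⟨n, j⟩, ⟨m, k⟩⟩ hr
        have : n ≠ m := by
          rintro rfl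
          exact hr ⟨(n, j, k), rfl⟩
        simp [b, this]
      · simpa [Function.comp_def, ι, b] using h1
    have h3 : HasSum (fun r : ℕ × ℕ => a (e r.1) x₁ * a (e r.2) x₂ * b (e r.1) (e r.2) y)
        (Ψ x₁ x₂ y) := by
      rw [← (e.prodCongr e).hasSum_iff] at h2
      exact h2
    -- Unconditional convergence contains convergence along rectangles.
    have ht : Tendsto (fun p : ℕ × ℕ => Finset.range p.1 ×ˢ Finset.range p.2) atTop atTop := by
      refine tendsto_finsetProd_atTop.comp (f := fun p : ℕ × ℕ =>
        (Finset.range p.1, Finset.range p.2)) ?_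
      rw [← prod_atTop_atTop_eq, ← prod_atTop_atTop_eq]
      exact tendsto_finset_range.prodMap tendsto_finset_range
    refine (h3.comp ht).congr fun p => ?_
    simp only [Function.comp]
    rw [Finset.sum_product]

end

noncomputable section

/-! ## Averages of bounded functions against translated Schwartz functions -/

open scoped FourierTransform RealInnerProductSpace

/-- The correlation `x ↦ ∫ G(z) Θ(z - x) dz`. -/
def correl (G : Plane → ℂ) (Θ : 𝓢(Plane, ℂ)) (x : Plane) : ℂ := ∫ z, G z * Θ (z - x)

/-- One majorant for all translations by at most `1`, used to dominate when passing to limits under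
correlation integrals. Decay of order `3` is integrable in dimension `2`, and `1 + ‖z‖ ≤ 2 (1 + ‖z -
q‖)` costs the factor `8`. -/
theorem SchwartzMap.exists_integrable_bound_translate (Θ : 𝓢(Plane, ℂ)) :
    ∃ b : Plane → ℝ, Integrable b ∧ ∀ z q : Plane, ‖q‖ ≤ 1 → ‖Θ (z - q)‖ ≤ b z := by
  set S := 2 ^ 3 * (Finset.Iic (3, 0)).sup
    (fun m : ℕ × ℕ => SchwartzMap.seminorm ℝ m.1 m.2 (E := Plane) (F := ℂ)) Θ with hS
  have hdec : ∀ x, (1 + ‖x‖) ^ 3 * ‖Θ x‖ ≤ S := fun x => by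
    simpa using SchwartzMap.one_add_le_sup_seminorm_apply (𝕜 := ℝ) (m := (3, 0))
      le_rfl le_rfl Θ x
  refine ⟨fun z => 8 * S * (1 + ‖z‖) ^ (-3 : ℝ), ?_, fun z q hq => ?_⟩
  · refine (integrable_one_add_norm ?_).const_mul _
    rw [finrank_euclideanSpace_fin]; norm_num
  · have h1 : 1 + ‖z‖ ≤ 2 * (1 + ‖z - q‖) := by
      have := norm_le_insert' z q
      have := norm_nonneg (z - q)
      linarith
    have h0 : 0 < 1 + ‖z‖ := by positivity
    beta_reduce
    rw [Real.rpow_neg h0.le, ← div_eq_mul_inv, le_div_iff₀ (by positivity)]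
    rw [show (3 : ℝ) = (3 : ℕ) by norm_num, Real.rpow_natCast]
    calc ‖Θ (z - q)‖ * (1 + ‖z‖) ^ 3 ≤ ‖Θ (z - q)‖ * (2 * (1 + ‖z - q‖)) ^ 3 := by gcongr
      _ = 8 * ((1 + ‖z - q‖) ^ 3 * ‖Θ (z - q)‖) := by ring
      _ ≤ 8 * S := by gcongr; exact hdec _

theorem SchwartzMap.integrable_comp_sub (Θ : 𝓢(Plane, ℂ)) (x : Plane) :
    Integrable fun z => Θ (z - x) := Θ.integrable.comp_sub_right x

variable {G : Plane → ℂ} {M : ℝ}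

theorem integrable_correl (hG : Measurable G) (hM : ∀ z, ‖G z‖ ≤ M) (Θ : 𝓢(Plane, ℂ)) (x : Plane) :
    Integrable fun z => G z * Θ (z - x) :=
  (Θ.integrable_comp_sub x).bdd_mul hG.aestronglyMeasurable (Eventually.of_forall hM)

theorem integral_norm_correl_le (hM : ∀ z, ‖G z‖ ≤ M) (Θ : 𝓢(Plane, ℂ)) (x : Plane) :
    ∫ z, ‖G z * Θ (z - x)‖ ≤ M * ∫ z, ‖Θ z‖ := by
  rw [← integral_sub_right_eq_self (fun z => ‖Θ z‖) x, ← integral_const_mul]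
  refine integral_mono_of_nonneg (Eventually.of_forall fun _ => norm_nonneg _)
    ((Θ.integrable_comp_sub x).norm.const_mul M) (Eventually.of_forall fun z => ?_)
  simp only [norm_mul]
  gcongr
  exact hM z

theorem norm_correl_le (hM : ∀ z, ‖G z‖ ≤ M) (Θ : 𝓢(Plane, ℂ)) (x : Plane) :
    ‖correl G Θ x‖ ≤ M * ∫ z, ‖Θ z‖ :=
  (norm_integral_le_integral_norm _).trans (integral_norm_correl_le hM Θ x)

theorem continuous_correl (hG : Measurable G) (hM : ∀ z, ‖G z‖ ≤ M) (Θ : 𝓢(Plane, ℂ)) :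
    Continuous (correl G Θ) := by
  obtain ⟨b, hb, hbd⟩ := Θ.exists_integrable_bound_translate
  refine continuous_iff_continuousAt.2 fun x₀ => ?_
  refine continuousAt_of_dominated (bound := fun z => M * b (z - x₀))
    (Eventually.of_forall fun x => (integrable_correl hG hM Θ x).aestronglyMeasurable) ?_
    ((hb.comp_sub_right x₀).const_mul M) (Eventually.of_forall fun z => ?_)
  · filter_upwards [Metric.closedBall_mem_nhds x₀ one_pos] with x hx
    refine Eventually.of_forall fun z => ?_
    have h := hbd (z - x₀) (x - x₀) (by simpa [dist_eq_norm] using hx)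
    rw [sub_sub_sub_cancel_right] at h
    rw [norm_mul]
    exact mul_le_mul (hM z) h (norm_nonneg _) ((norm_nonneg _).trans (hM z))
  · exact (continuous_const.mul (Θ.continuous.comp (continuous_const.sub continuous_id))).continuousAt

theorem hasDerivAt_correl (hG : Measurable G) (hM : ∀ z, ‖G z‖ ≤ M) (Θ : 𝓢(Plane, ℂ))
    (p : Plane) {e : Plane} (he : ‖e‖ ≤ 1) (t : ℝ) :
    HasDerivAt (fun t : ℝ => correl G Θ (p + t • e)) (correl G (-∂_{e} Θ) (p + t • e)) t := by
  obtain ⟨b, hb, hbd⟩ := (-∂_{e} Θ).exists_integrable_bound_translate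
  refine (hasDerivAt_integral_of_dominated_loc_of_deriv_le (s := Metric.closedBall t 1)
    (bound := fun z => M * b (z - (p + t • e)))
    (F := fun t z => G z * Θ (z - (p + t • e))) (F' := fun t z => G z * (-∂_{e} Θ) (z - (p + t • e)))
    (Metric.closedBall_mem_nhds t one_pos)
    (Eventually.of_forall fun t => (integrable_correl hG hM Θ _).aestronglyMeasurable)
    (integrable_correl hG hM Θ _) (integrable_correl hG hM (-∂_{e} Θ) _).aestronglyMeasurable
    (Eventually.of_forall fun z r hr => ?_) ((hb.comp_sub_right _).const_mul M)
    (Eventually.of_forall fun z r _ => ?_)).2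
  · have h := hbd (z - (p + t • e)) ((r - t) • e) (by
      rw [norm_smul]
      have : ‖r - t‖ ≤ 1 := by simpa [dist_eq_norm] using hr
      nlinarith [norm_nonneg (r - t), norm_nonneg e])
    rw [show z - (p + t • e) - (r - t) • e = z - (p + r • e) by rw [sub_smul]; abel] at h
    rw [norm_mul]
    exact mul_le_mul (hM z) h (norm_nonneg _) ((norm_nonneg _).trans (hM z))
  · refine HasDerivAt.const_mul _ ?_
    have h1 : HasDerivAt (fun r : ℝ => z - (p + r • e)) (-e) r := by
      have := (((hasDerivAt_id r).smul_const e).const_add p).const_sub z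
      simpa using this
    have h2 := (Θ.hasFDerivAt (z - (p + r • e))).comp_hasDerivAt r h1
    rw [map_neg, ← SchwartzMap.lineDerivOp_apply_eq_fderiv] at h2
    exact h2

/-- Along a line, `𝓕 θ` is a superposition of exponentials of frequency `a ⟪ξ, e⟫`, at most `1/4` in
modulus; each of them is sampled exactly. -/
theorem hasSum_fourier_samplingKernel {θ : 𝓢(Plane, ℂ)} (hθ : ∀ ξ, θ ξ ≠ 0 → ‖ξ‖ ≤ 1 / 4)
    (y : Plane) {e : Plane} (he : ‖e‖ ≤ 1) {a : ℝ} (ha : a ∈ Set.Icc (0 : ℝ) 1) (x : ℝ) :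
    HasSum (fun j : ℤ => samplingKernel (x - j) * 𝓕 θ (y - (a * j) • e))
      (𝓕 θ (y - (a * x) • e)) := by
  have hF : ∀ z : Plane, 𝓕 θ z = ∫ ξ, Complex.exp (↑(-2 * Real.pi * ⟪ξ, z⟫) * Complex.I) * θ ξ :=
    fun z => by rw [SchwartzMap.fourier_coe, Real.fourier_eq']; rfl
  have hexp : ∀ (t : ℝ), ‖Complex.exp (t * Complex.I)‖ = 1 := Complex.norm_exp_ofReal_mul_I
  have hint : ∀ z : Plane, Integrable fun ξ =>
      Complex.exp (↑(-2 * Real.pi * ⟪ξ, z⟫) * Complex.I) * θ ξ := fun z => by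
    refine θ.integrable.bdd_mul (c := 1) (Continuous.aestronglyMeasurable (by fun_prop)) ?_
    exact Eventually.of_forall fun ξ => (hexp _).le
  have hpt : ∀ ξ, HasSum (fun j : ℤ => samplingKernel (x - j) *
      (Complex.exp (↑(-2 * Real.pi * ⟪ξ, y - (a * j) • e⟫) * Complex.I) * θ ξ))
      (Complex.exp (↑(-2 * Real.pi * ⟪ξ, y - (a * x) • e⟫) * Complex.I) * θ ξ) := by
    intro ξ
    by_cases h0 : θ ξ = 0
    · simp [h0]
    have ht : |a * ⟪ξ, e⟫| ≤ 1 / 4 := by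
      rw [abs_mul, abs_of_nonneg ha.1]
      have h1 := abs_real_inner_le_norm ξ e
      have h2 := hθ ξ h0
      have h3 : ‖ξ‖ * ‖e‖ ≤ 1 / 4 * 1 := by gcongr
      nlinarith [abs_nonneg ⟪ξ, e⟫, ha.1, ha.2]
    have h := (hasSum_samplingKernel_exp x ht).mul_left
      (Complex.exp (↑(-2 * Real.pi * ⟪ξ, y⟫) * Complex.I) * θ ξ)
    have hsplit : ∀ r : ℝ, Complex.exp (↑(-2 * Real.pi * ⟪ξ, y - (a * r) • e⟫) * Complex.I) =
        Complex.exp (↑(-2 * Real.pi * ⟪ξ, y⟫) * Complex.I) *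
          Complex.exp (2 * Real.pi * Complex.I * r * (a * ⟪ξ, e⟫ : ℝ)) := by
      intro r
      rw [← Complex.exp_add, inner_sub_right, real_inner_smul_right]
      congr 1
      push_cast; ring
    have e1 : ∀ j : ℤ, samplingKernel (x - j) *
        (Complex.exp (↑(-2 * Real.pi * ⟪ξ, y - (a * j) • e⟫) * Complex.I) * θ ξ) =
        Complex.exp (↑(-2 * Real.pi * ⟪ξ, y⟫) * Complex.I) * θ ξ * (samplingKernel (x - j) *
          Complex.exp (2 * Real.pi * Complex.I * j * (a * ⟪ξ, e⟫ : ℝ))) := by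
      intro j
      rw [hsplit, Complex.ofReal_intCast]; ring
    rw [funext e1, hsplit, mul_right_comm (Complex.exp _)]
    exact h
  have := hasSum_integral_of_summable_integral_norm (μ := volume)
    (F := fun (j : ℤ) (ξ : Plane) => samplingKernel (x - j) *
      (Complex.exp (↑(-2 * Real.pi * ⟪ξ, y - (a * j) • e⟫) * Complex.I) * θ ξ))
    (fun j => (hint _).const_mul _) (by
      simp_rw [norm_mul, hexp, one_mul, integral_const_mul]
      exact (summable_norm_samplingKernel x).mul_right _)
  rw [integral_congr_ae (Eventually.of_forall fun ξ => (hpt ξ).tsum_eq), ← hF] at this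
  simp_rw [integral_const_mul, ← hF] at this
  exact this

theorem isSampled_correl (hG : Measurable G) (hM : ∀ z, ‖G z‖ ≤ M) {θ : 𝓢(Plane, ℂ)}
    (hθ : ∀ ξ, θ ξ ≠ 0 → ‖ξ‖ ≤ 1 / 4) (p : Plane) {e : Plane} (he : ‖e‖ ≤ 1) :
    IsSampled fun t => correl G (𝓕 θ) (p + t • e) := by
  intro a ha b x
  have hpt : ∀ z, HasSum (fun j : ℤ => samplingKernel (x - j) *
      (G z * 𝓕 θ (z - (p + (a * j + b) • e)))) (G z * 𝓕 θ (z - (p + (a * x + b) • e))) := by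
    intro z
    have h := (hasSum_fourier_samplingKernel hθ (z - p - b • e) he ha x).mul_left (G z)
    have e1 : ∀ r : ℝ, z - p - b • e - (a * r) • e = z - (p + (a * r + b) • e) := fun r => by
      rw [add_smul]; abel
    simp_rw [e1, mul_left_comm (G z)] at h
    exact h
  have := hasSum_integral_of_summable_integral_norm (μ := volume)
    (F := fun (j : ℤ) (z : Plane) => samplingKernel (x - j) *
      (G z * 𝓕 θ (z - (p + (a * j + b) • e))))
    (fun j => (integrable_correl hG hM _ _).const_mul _) (by
      simp_rw [norm_mul (samplingKernel _), integral_const_mul]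
      refine Summable.of_nonneg_of_le (fun j => by positivity) (fun j => ?_)
        ((summable_norm_samplingKernel x).mul_right (M * ∫ z, ‖𝓕 θ z‖))
      gcongr
      exact integral_norm_correl_le hM _ _)
  rw [integral_congr_ae (Eventually.of_forall fun z => (hpt z).tsum_eq)] at this
  simp_rw [integral_const_mul] at this
  exact this

/-! ## The band-limiting kernel -/

/-- A smooth bump on the plane which is `1` for `‖ξ‖ ≤ 1/5` and vanishes for `‖ξ‖ ≥ 1/4`. -/
def planeBump : ContDiffBump (0 : Plane) where
  rIn := 1 / 5
  rOut := 1 / 4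
  rIn_pos := by norm_num
  rIn_lt_rOut := by norm_num

/-- The bump on the plane as a complex valued Schwartz function. -/
def freqBump : 𝓢(Plane, ℂ) :=
  (planeBump.hasCompactSupport.comp_left Complex.ofReal_zero :
    HasCompactSupport (Complex.ofReal ∘ planeBump)).toSchwartzMap
    (Complex.ofRealCLM.contDiff.comp planeBump.contDiff)

theorem freqBump_apply (ξ : Plane) : freqBump ξ = planeBump ξ := rfl

theorem freqBump_eq_one {ξ : Plane} (h : ‖ξ‖ ≤ 1 / 5) : freqBump ξ = 1 := by
  rw [freqBump_apply, planeBump.one_of_mem_closedBall (by simpa [planeBump] using h)]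
  simp

theorem norm_le_of_freqBump_ne_zero {ξ : Plane} (h : freqBump ξ ≠ 0) : ‖ξ‖ ≤ 1 / 4 := by
  by_contra! h'
  refine h ?_
  rw [freqBump_apply, planeBump.zero_of_le_dist]
  · simp
  · simpa [planeBump] using h'.le

/-- The kernel of the band-limiting operator, the Fourier transform of the bump. -/
def bandKernel : 𝓢(Plane, ℂ) := 𝓕 freqBump

/-- The bump multiplied by the symbol of the derivative in the direction `e`. -/
def derivFreqBump (e : Plane) : 𝓢(Plane, ℂ) :=
  -(-(2 * Real.pi * Complex.I) • SchwartzMap.smulLeftCLM ℂ (inner ℝ · e) freqBump)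

/-- Differentiation multiplies by a symbol and does not enlarge the spectrum, so derivatives of
correlations are sampled too. -/
theorem neg_lineDeriv_bandKernel (e : Plane) : -∂_{e} bandKernel = 𝓕 (derivFreqBump e) := by
  rw [bandKernel, SchwartzMap.lineDerivOp_fourier_eq, derivFreqBump, FourierTransform.fourier_neg]

theorem norm_le_of_derivFreqBump_ne_zero {e ξ : Plane} (h : derivFreqBump e ξ ≠ 0) :
    ‖ξ‖ ≤ 1 / 4 := by
  refine norm_le_of_freqBump_ne_zero fun h0 => h ?_
  simp [derivFreqBump,
    SchwartzMap.smulLeftCLM_apply_apply (Function.hasTemperateGrowth_inner_left e), h0]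

/-- A constant that bounds the kernel of the band-limiting operator and its derivative in the
direction `e`. -/
def bandBound (e : Plane) : ℝ := (∫ z, ‖bandKernel z‖) + ∫ z, ‖(-∂_{e} bandKernel) z‖

theorem bandBound_nonneg (e : Plane) : 0 ≤ bandBound e := by unfold bandBound; positivity

theorem norm_correl_bandKernel_le (hM : ∀ z, ‖G z‖ ≤ M) (e x : Plane) :
    ‖correl G bandKernel x‖ ≤ M * bandBound e := by
  have : 0 ≤ M := (norm_nonneg _).trans (hM 0)
  refine (norm_correl_le hM _ x).trans ?_
  gcongr
  unfold bandBound
  have : 0 ≤ ∫ z, ‖(-∂_{e} bandKernel) z‖ := by positivity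
  linarith

theorem norm_correl_deriv_bandKernel_le (hM : ∀ z, ‖G z‖ ≤ M) (e x : Plane) :
    ‖correl G (-∂_{e} bandKernel) x‖ ≤ M * bandBound e := by
  have : 0 ≤ M := (norm_nonneg _).trans (hM 0)
  refine (norm_correl_le hM _ x).trans ?_
  gcongr
  unfold bandBound
  have : 0 ≤ ∫ z, ‖bandKernel z‖ := by positivity
  linarith

theorem hasSum_lineDiff_correl (hG : Measurable G) (hM : ∀ z, ‖G z‖ ≤ M) (p : Plane) {e : Plane}
    (he : ‖e‖ ≤ 1) (x₁ x₂ : ℝ) :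
    HasSum (fun q : ℤ × ℤ => samplingKernel (x₁ - q.1) * samplingKernel (x₂ - q.2) *
      lineDiff (fun t => correl G bandKernel (p + t • e)) q.1 q.2)
      (lineDiff (fun t => correl G bandKernel (p + t • e)) x₁ x₂) := by
  refine hasSum_lineDiff (fun t => hasDerivAt_correl hG hM bandKernel p he t)
    ((continuous_correl hG hM _).comp (by fun_prop))
    (fun t => norm_correl_deriv_bandKernel_le hM e _) ?_ x₁ x₂
  rw [neg_lineDeriv_bandKernel]
  exact isSampled_correl hG hM (fun ξ => norm_le_of_derivFreqBump_ne_zero) p he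

theorem norm_lineDiff_correl_le (hG : Measurable G) (hM : ∀ z, ‖G z‖ ≤ M) (p : Plane) {e : Plane}
    (he : ‖e‖ ≤ 1) (x₁ x₂ : ℝ) :
    ‖lineDiff (fun t => correl G bandKernel (p + t • e)) x₁ x₂‖ ≤ M * bandBound e :=
  norm_lineDiff_le (fun t => hasDerivAt_correl hG hM bandKernel p he t)
    ((continuous_correl hG hM _).comp (by fun_prop))
    (fun t => norm_correl_deriv_bandKernel_le hM e _) x₁ x₂

theorem bilinearBound_lineDiff_correl (hG : Measurable G) (hM : ∀ z, ‖G z‖ ≤ M) (p : Plane)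
    {e : Plane} (he : ‖e‖ ≤ 1) :
    BilinearBound (fun j k : ℤ => lineDiff (fun t => correl G bandKernel (p + t • e)) j k)
      (M * (bandBound e * (2 * Real.pi + 1))) := by
  refine (bilinearBound_lineDiff (fun t => norm_correl_bandKernel_le hM e _) fun t => ?_).mono
    (le_of_eq ?_) (C := 2 * (M * bandBound e) * Real.pi + M * bandBound e)
  · rw [(hasDerivAt_correl hG hM bandKernel p he t).deriv]
    exact norm_correl_deriv_bandKernel_le hM e _
  · ring

/-- Supplies measurability of the matrix entries in the frozen variable. -/
theorem continuous_lineDiff_correl (hG : Measurable G) (hM : ∀ z, ‖G z‖ ≤ M) {p : ℝ → Plane}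
    (hp : Continuous p) {e : Plane} (he : ‖e‖ ≤ 1) (x₁ x₂ : ℝ) :
    Continuous fun y => lineDiff (fun t => correl G bandKernel (p y + t • e)) x₁ x₂ := by
  unfold lineDiff
  have h := continuous_correl hG hM bandKernel
  split_ifs
  · simp_rw [(hasDerivAt_correl hG hM bandKernel _ he _).deriv]
    exact (continuous_correl hG hM _).comp (by fun_prop)
  · fun_prop

end

noncomputable section

/-! ## Littlewood–Paley pieces as band-limited functions -/

open scoped FourierTransform RealInnerProductSpace

theorem IsLittlewoodPaleyCutoff.eq_zero_of_lt {w : ℝ → ℝ} (hw : IsLittlewoodPaleyCutoff w) {s : ℝ}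
    (hs : s < 1 / 2 ∨ 2 < s) : w s = 0 := by
  by_contra h
  have := hw.support_subset (subset_tsupport w h)
  rcases hs with h | h <;> linarith [this.1, this.2]

theorem IsLittlewoodPaleyCutoff.contDiff_comp_norm {w : ℝ → ℝ} (hw : IsLittlewoodPaleyCutoff w) :
    ContDiff ℝ ∞ fun ξ : Plane => w ‖ξ‖ := by
  refine contDiff_iff_contDiffAt.2 fun ξ => ?_
  rcases eq_or_ne ξ 0 with rfl | h
  · have : (fun ξ : Plane => w ‖ξ‖) =ᶠ[𝓝 0] fun _ => 0 := by
      filter_upwards [Metric.ball_mem_nhds (0 : Plane) (by norm_num : (0 : ℝ) < 1 / 2)] with ξ hξ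
      exact hw.eq_zero_of_lt (Or.inl (by simpa using hξ))
    exact contDiffAt_const.congr_of_eventuallyEq this
  · exact hw.contDiff.contDiffAt.comp ξ (contDiffAt_norm ℝ h)

/-- The symbol of the `n`-th Littlewood–Paley piece. -/
def lpSymbol (w : ℝ → ℝ) (n : ℤ) (ξ : Plane) : ℂ :=
  ((w (‖(2 * Real.pi) • ξ‖ / (2 : ℝ) ^ n) : ℝ) : ℂ)

/-- On the support `2π‖ξ‖ ≤ 2 ^ (n + 1)`, and `1 / (2π) < 1/5`. This places the dilated symbol where
`freqBump` equals `1`. -/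
theorem norm_le_of_lpSymbol_ne_zero {w : ℝ → ℝ} (hw : IsLittlewoodPaleyCutoff w) {n : ℤ} {ξ : Plane}
    (h : lpSymbol w n ξ ≠ 0) : ‖((2 : ℝ) ^ (n + 1))⁻¹ • ξ‖ ≤ 1 / 5 := by
  have h2 : ‖(2 * Real.pi) • ξ‖ / (2 : ℝ) ^ n ≤ 2 := by
    by_contra! h2
    exact h (by rw [lpSymbol, hw.eq_zero_of_lt (Or.inr h2), Complex.ofReal_zero])
  have hp : (0 : ℝ) < 2 ^ n := by positivity
  rw [div_le_iff₀ hp, norm_smul, Real.norm_of_nonneg (by positivity)] at h2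
  rw [norm_smul, Real.norm_of_nonneg (by positivity), zpow_add_one₀ two_ne_zero,
    inv_mul_le_iff₀ (by positivity)]
  have := Real.pi_gt_three
  nlinarith [norm_nonneg ξ]

theorem hasTemperateGrowth_lpSymbol {w : ℝ → ℝ} (hw : IsLittlewoodPaleyCutoff w) (n : ℤ) :
    (lpSymbol w n).HasTemperateGrowth := by
  have e : lpSymbol w n = fun ξ : Plane =>
      ((w ‖(((2 : ℝ) ^ n)⁻¹ * (2 * Real.pi)) • ξ‖ : ℝ) : ℂ) := by
    ext ξ
    rw [lpSymbol, mul_smul _ (2 * Real.pi), norm_smul (((2 : ℝ) ^ n)⁻¹),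
      Real.norm_of_nonneg (by positivity), div_eq_inv_mul]
  refine HasCompactSupport.hasTemperateGrowth ?_ ?_
  · refine HasCompactSupport.of_support_subset_isCompact
      (isCompact_closedBall (0 : Plane) (2 ^ (n + 1) * (1 / 5))) fun ξ hξ => ?_
    have := norm_le_of_lpSymbol_ne_zero hw hξ
    rw [norm_smul, Real.norm_of_nonneg (by positivity), inv_mul_le_iff₀ (by positivity)] at this
    simpa using this
  · rw [e]
    exact Complex.ofRealCLM.contDiff.comp
      (hw.contDiff_comp_norm.comp (contDiff_const_smul _))

/-- The dilated bump. -/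
def scaledBump (ρ : ℝ) (ξ : Plane) : ℂ := freqBump (ρ⁻¹ • ξ)

theorem contDiff_scaledBump (ρ : ℝ) : ContDiff ℝ ∞ (scaledBump ρ) :=
  (freqBump.smooth ⊤).comp (contDiff_const_smul _)

theorem hasCompactSupport_scaledBump {ρ : ℝ} (hρ : 0 < ρ) : HasCompactSupport (scaledBump ρ) := by
  refine HasCompactSupport.of_support_subset_isCompact
    (isCompact_closedBall (0 : Plane) (ρ * (1 / 4))) fun ξ hξ => ?_
  have := norm_le_of_freqBump_ne_zero hξ
  rw [norm_smul, Real.norm_of_nonneg (by positivity), inv_mul_le_iff₀ hρ] at this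
  simpa using this

theorem hasTemperateGrowth_scaledBump {ρ : ℝ} (hρ : 0 < ρ) :
    (scaledBump ρ).HasTemperateGrowth :=
  (hasCompactSupport_scaledBump hρ).hasTemperateGrowth (contDiff_scaledBump ρ)

theorem fourierMultiplier_scaledBump_lpPiece {w : ℝ → ℝ} (hw : IsLittlewoodPaleyCutoff w) (n : ℤ)
    (u : 𝓢'(Plane, ℂ)) : TemperedDistribution.fourierMultiplierCLM ℂ (scaledBump (2 ^ (n + 1)))
      (lpPiece w n u) = lpPiece w n u := by
  change TemperedDistribution.fourierMultiplierCLM ℂ _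
    (TemperedDistribution.fourierMultiplierCLM ℂ (lpSymbol w n) u) =
    TemperedDistribution.fourierMultiplierCLM ℂ (lpSymbol w n) u
  rw [TemperedDistribution.fourierMultiplierCLM_fourierMultiplierCLM_apply
    (hasTemperateGrowth_lpSymbol hw n) (hasTemperateGrowth_scaledBump (by positivity))]
  refine congrArg (fun g => TemperedDistribution.fourierMultiplierCLM ℂ g u) ?_
  ext ξ
  simp only [Pi.mul_apply]
  by_cases h : lpSymbol w n ξ = 0
  · simp [h]
  · rw [scaledBump, freqBump_eq_one (norm_le_of_lpSymbol_ne_zero hw h), mul_one]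

/-- This is the action of the multiplier on test functions: move `𝓕⁻` from `φ` to the other factor
and substitute `ξ = ρ ζ`, whose Jacobian in the plane is `ρ²`. -/
theorem fourier_smulLeft_scaledBump {ρ : ℝ} (hρ : 0 < ρ) (φ : 𝓢(Plane, ℂ)) (z : Plane) :
    𝓕 (SchwartzMap.smulLeftCLM ℂ (scaledBump ρ) (𝓕⁻ φ)) z =
      ∫ x, φ x * ((ρ ^ 2 : ℝ) * bandKernel (ρ • (z - x))) := by
  let e : Plane → Plane → ℂ := fun z ξ => Complex.exp (↑(-2 * Real.pi * ⟪ξ, z⟫) * Complex.I)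
  let h : 𝓢(Plane, ℂ) := (HasCompactSupport.mul_right (f' := e z)
    (hasCompactSupport_scaledBump hρ)).toSchwartzMap ((contDiff_scaledBump ρ).mul
      (Complex.contDiff_exp.comp ((Complex.ofRealCLM.contDiff.comp
        (contDiff_const.mul (contDiff_id.inner ℝ contDiff_const))).mul contDiff_const)))
  have hh : ∀ ξ, h ξ = scaledBump ρ ξ * e z ξ := fun _ => rfl
  have h1 : 𝓕 (SchwartzMap.smulLeftCLM ℂ (scaledBump ρ) (𝓕⁻ φ)) z = ∫ ξ, 𝓕⁻ φ ξ * h ξ := by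
    rw [SchwartzMap.fourier_coe, Real.fourier_eq']
    refine integral_congr_ae (Eventually.of_forall fun ξ => ?_)
    simp only [SchwartzMap.smulLeftCLM_apply_apply (hasTemperateGrowth_scaledBump hρ), hh, e,
      smul_eq_mul]
    ring
  rw [h1, SchwartzMap.integral_fourierInv_mul_eq]
  refine integral_congr_ae (Eventually.of_forall fun x => ?_)
  simp only
  congr 1
  rw [SchwartzMap.fourierInv_coe, Real.fourierInv_eq', bandKernel, SchwartzMap.fourier_coe,
    Real.fourier_eq']
  have h2 := Measure.integral_comp_inv_smul (μ := (volume : Measure Plane))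
    (fun ζ : Plane => e (ρ • (z - x)) ζ * freqBump ζ) ρ
  rw [finrank_euclideanSpace_fin, abs_of_pos (by positivity), Complex.real_smul] at h2
  refine Eq.trans ?_ h2
  refine integral_congr_ae (Eventually.of_forall fun ξ => ?_)
  simp only [hh, e, smul_eq_mul, scaledBump]
  rw [mul_left_comm, mul_comm, ← Complex.exp_add]
  congr 2
  rw [real_inner_smul_left, real_inner_smul_right, inner_sub_right]
  have : ρ⁻¹ * (ρ * (⟪ξ, z⟫ - ⟪ξ, x⟫)) = ⟪ξ, z⟫ - ⟪ξ, x⟫ := by field_simp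
  rw [this]
  push_cast; ring

theorem correl_dilation (G : Plane → ℂ) {ρ : ℝ} (hρ : 0 < ρ) (x : Plane) :
    ∫ z, ((ρ ^ 2 : ℝ) * bandKernel (ρ • (z - x))) * G z =
      correl (fun z => G (ρ⁻¹ • z)) bandKernel (ρ • x) := by
  have h2 := Measure.integral_comp_smul (μ := (volume : Measure Plane))
    (fun z : Plane => G (ρ⁻¹ • z) * bandKernel (z - ρ • x)) ρ
  rw [finrank_euclideanSpace_fin, abs_of_pos (by positivity), Complex.real_smul] at h2
  simp_rw [mul_assoc, integral_const_mul]
  have h3 : ∀ z, bandKernel (ρ • (z - x)) * G z =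
      G (ρ⁻¹ • ρ • z) * bandKernel (ρ • z - ρ • x) := fun z => by
    rw [inv_smul_smul₀ hρ.ne', smul_sub, mul_comm]
  simp_rw [h3]
  rw [h2, ← mul_assoc, ← Complex.ofReal_mul, mul_inv_cancel₀ (by positivity), Complex.ofReal_one,
    one_mul]
  rfl

theorem fourierMultiplier_scaledBump_apply {G : Plane → ℂ} {M : ℝ} (hG : Measurable G)
    (hM : ∀ z, ‖G z‖ ≤ M) {v : 𝓢'(Plane, ℂ)} (hv : ∀ φ : 𝓢(Plane, ℂ), v φ = ∫ z, φ z * G z)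
    {ρ : ℝ} (hρ : 0 < ρ) (φ : 𝓢(Plane, ℂ)) :
    TemperedDistribution.fourierMultiplierCLM ℂ (scaledBump ρ) v φ =
      ∫ x, φ x * correl (fun z => G (ρ⁻¹ • z)) bandKernel (ρ • x) := by
  rw [TemperedDistribution.fourierMultiplierCLM_apply_apply, hv]
  simp_rw [fourier_smulLeft_scaledBump hρ, ← integral_mul_const]
  have hk : Integrable fun x : Plane => ((ρ ^ 2 : ℝ) : ℂ) * bandKernel (ρ • x) :=
    ((bandKernel.integrable (μ := volume)).comp_smul hρ.ne').const_mul _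
  have hI := (φ.integrable (μ := volume)).convolution_integrand (ContinuousLinearMap.mul ℂ ℂ) hk
  rw [integral_integral_swap]
  · refine integral_congr_ae (Eventually.of_forall fun x => ?_)
    simp only [mul_assoc (φ x), integral_const_mul]
    rw [correl_dilation G hρ]
  · exact hI.mul_bdd (c := M) (hG.comp measurable_fst).aestronglyMeasurable
      (Eventually.of_forall fun p => hM _)

/-- Changing `F` on a null set makes the bound hold everywhere, as the correlation estimates assume.
-/
theorem Lp.exists_bounded_representative (F : Lp ℂ ⊤ (volume : Measure Plane)) :
    ∃ G : Plane → ℂ, Measurable G ∧ (∀ z, ‖G z‖ ≤ ‖F‖) ∧ F =ᵐ[volume] G := by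
  obtain ⟨g, hg, hFg⟩ := (Lp.aestronglyMeasurable F)
  have hb : ∀ᵐ z ∂(volume : Measure Plane), ‖F z‖ ≤ ‖F‖ := by
    have h := ae_le_eLpNormEssSup (f := F) (μ := (volume : Measure Plane))
    rw [← eLpNorm_exponent_top] at h
    filter_upwards [h] with z hz
    rw [Lp.norm_def, ← toReal_enorm]
    exact ENNReal.toReal_mono (Lp.eLpNorm_ne_top F) hz
  have hs : MeasurableSet {z | ‖g z‖ ≤ ‖F‖} := measurableSet_le hg.measurable.norm measurable_const
  refine ⟨{z | ‖g z‖ ≤ ‖F‖}.indicator g, hg.measurable.indicator hs, fun z => ?_, ?_⟩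
  · by_cases hz : z ∈ {z | ‖g z‖ ≤ ‖F‖}
    · rw [Set.indicator_of_mem hz]; exact hz
    · rw [Set.indicator_of_notMem hz]; simp
  · filter_upwards [hb, hFg] with z h1 h2
    rw [Set.indicator_of_mem]
    · exact h2
    · change ‖g z‖ ≤ ‖F‖
      rwa [← h2]

/-- `L^∞` embeds injectively into distributions, so the infimum runs over a single element. -/
theorem exists_lp_eq_of_distLinftyNorm_lt_top {v : 𝓢'(Plane, ℂ)} (h : distLinftyNorm v < ⊤) :
    ∃ F : Lp ℂ ⊤ (volume : Measure Plane), Lp.toTemperedDistribution F = v ∧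
      distLinftyNorm v = ‖F‖ₑ := by
  unfold distLinftyNorm at h ⊢
  simp only [iInf_lt_iff] at h
  obtain ⟨F, hF, -⟩ := h
  refine ⟨F, hF, le_antisymm (iInf₂_le F hF) (le_iInf₂ fun F' hF' => le_of_eq ?_)⟩
  have hinj : Function.Injective (Lp.toTemperedDistributionCLM ℂ (volume : Measure Plane) ⊤) :=
    LinearMap.ker_eq_bot.1 Lp.ker_toTemperedDistributionCLM_eq_bot
  rw [hinj (hF.trans hF'.symm)]

/-- The Littlewood–Paley pieces with finite `L^∞` norm are dilations of correlations of bounded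
functions with the band-limiting kernel. -/
theorem exists_lpPiece_eq_correl {w : ℝ → ℝ} (hw : IsLittlewoodPaleyCutoff w) (n : ℤ)
    {u : 𝓢'(Plane, ℂ)} (h : distLinftyNorm (lpPiece w n u) < ⊤) :
    ∃ (G : Plane → ℂ) (M : ℝ), Measurable G ∧ (∀ z, ‖G z‖ ≤ M) ∧
      ENNReal.ofReal M = distLinftyNorm (lpPiece w n u) ∧
      ∀ φ : 𝓢(Plane, ℂ), lpPiece w n u φ =
        ∫ x, φ x * correl G bandKernel ((2 : ℝ) ^ (n + 1) • x) := by
  obtain ⟨F, hF, hFn⟩ := exists_lp_eq_of_distLinftyNorm_lt_top h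
  obtain ⟨G, hG, hGM, hFG⟩ := Lp.exists_bounded_representative F
  refine ⟨fun z => G (((2 : ℝ) ^ (n + 1))⁻¹ • z), ‖F‖, hG.comp (measurable_const_smul _),
    fun z => hGM _, by rw [hFn, ofReal_norm], fun φ => ?_⟩
  rw [← fourierMultiplier_scaledBump_lpPiece hw]
  refine fourierMultiplier_scaledBump_apply hG hGM (fun φ => ?_) (by positivity) φ
  rw [← hF, Lp.toTemperedDistribution_apply]
  refine integral_congr_ae ?_
  filter_upwards [hFG] with z hz
  rw [hz, smul_eq_mul]

/-! ## Continuous functions with continuous weak derivatives -/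

open scoped Convolution

/-- The translated mollifier `ψ(x - ·)` is itself an admissible test function, so the weak identity
moves the derivative from `ψ` onto `F`. -/
theorem hasDerivAt_convolution_of_weak {f F : Plane → ℂ} (hf : Continuous f)
    {e : Plane} (h : ∀ φ : 𝓢(Plane, ℂ), HasCompactSupport φ →
      ∫ x, (∂_{e} φ) x * f x = -∫ x, φ x * F x) (ψ : ContDiffBump (0 : Plane)) (p : Plane) (s : ℝ) :
    HasDerivAt (fun s : ℝ => (ψ.normed volume ⋆[ContinuousLinearMap.lsmul ℝ ℝ] f) (p + s • e))
      ((ψ.normed volume ⋆[ContinuousLinearMap.lsmul ℝ ℝ] F) (p + s • e)) s := by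
  have h1 := (ψ.hasCompactSupport_normed (μ := volume)).hasFDerivAt_convolution_left
    (ContinuousLinearMap.lsmul ℝ ℝ) (μ := volume) (ψ.contDiff_normed (μ := volume) (n := 1))
    hf.locallyIntegrable (p + s • e)
  have h2 : HasDerivAt (fun s : ℝ => p + s • e) e s := by
    simpa using ((hasDerivAt_id s).smul_const e).const_add p
  have h3 := h1.comp_hasDerivAt s h2
  set x := p + s • e
  suffices hval : (ψ.normed volume ⋆[ContinuousLinearMap.lsmul ℝ ℝ] F) x =
      (fderiv ℝ (ψ.normed volume) ⋆[(ContinuousLinearMap.lsmul ℝ ℝ).precompL Plane] f) x e by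
    rw [hval]
    exact h3
  have hcs : HasCompactSupport fun t => ((ψ.normed volume (x - t) : ℝ) : ℂ) := by
    have := (ψ.hasCompactSupport_normed (μ := volume)).comp_homeomorph (Homeomorph.subLeft x)
    exact this.comp_left Complex.ofReal_zero
  have hcd : ContDiff ℝ ∞ fun t => ((ψ.normed volume (x - t) : ℝ) : ℂ) :=
    Complex.ofRealCLM.contDiff.comp (ψ.contDiff_normed.comp (contDiff_const.sub contDiff_id))
  let φ : 𝓢(Plane, ℂ) := hcs.toSchwartzMap hcd
  have hφ : ∀ t, (∂_{e} φ) t = -((fderiv ℝ (ψ.normed volume) (x - t) e : ℝ) : ℂ) := by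
    intro t
    rw [SchwartzMap.lineDerivOp_apply_eq_fderiv]
    have hd : HasFDerivAt (ψ.normed volume) (fderiv ℝ (ψ.normed volume) (x - t)) (x - t) :=
      ((ψ.contDiff_normed (n := 1)).differentiable one_ne_zero _).hasFDerivAt
    have := Complex.ofRealCLM.hasFDerivAt.comp t
      (hd.comp t ((hasFDerivAt_id (𝕜 := ℝ) t).const_sub x))
    have e1 : HasFDerivAt φ _ t := this
    rw [e1.fderiv]
    simp
  have h4 := h φ hcs
  rw [convolution_eq_swap, convolution_def]
  have hint : Integrable fun t => ((ContinuousLinearMap.lsmul ℝ ℝ).precompL Plane)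
      (fderiv ℝ (ψ.normed volume) t) (f (x - t)) := by
    have hc : Continuous (fderiv ℝ (ψ.normed (volume : Measure Plane))) :=
      (ψ.contDiff_normed (n := 1)).continuous_fderiv one_ne_zero
    refine Continuous.integrable_of_hasCompactSupport ?_ ?_
    · exact (((ContinuousLinearMap.lsmul ℝ ℝ).precompL Plane).continuous.comp hc).clm_apply
        (hf.comp (continuous_const.sub continuous_id))
    · refine ((ψ.hasCompactSupport_normed (μ := volume)).fderiv ℝ).mono fun t ht => ?_
      contrapose! ht
      simp only [Function.mem_support, not_not] at ht ⊢
      simp [ht]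
  rw [ContinuousLinearMap.integral_apply hint]
  simp only [ContinuousLinearMap.precompL_apply, ContinuousLinearMap.lsmul_apply,
    Complex.real_smul]
  rw [← integral_sub_left_eq_self (fun t => ((fderiv ℝ (ψ.normed volume) t e : ℝ) : ℂ) * f (x - t))
    volume x]
  simp only [sub_sub_cancel, hφ, neg_mul, integral_neg, neg_inj] at h4 ⊢
  exact h4.symm

/-- The fundamental theorem of calculus holds for the mollified functions; let the radius tend to
`0`, with the bound `D` as majorant. -/
theorem sub_eq_intervalIntegral_of_weak {f F : Plane → ℂ} (hf : Continuous f) (hF : Continuous F)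
    {D : ℝ} (hD : ∀ x, ‖F x‖ ≤ D) {e : Plane} (h : ∀ φ : 𝓢(Plane, ℂ), HasCompactSupport φ →
      ∫ x, (∂_{e} φ) x * f x = -∫ x, φ x * F x) (p : Plane) (a b : ℝ) :
    f (p + b • e) - f (p + a • e) = ∫ s in a..b, F (p + s • e) := by
  let ψ : ℕ → ContDiffBump (0 : Plane) := fun n =>
    { rIn := 1 / (n + 1) / 2
      rOut := 1 / (n + 1)
      rIn_pos := by positivity
      rIn_lt_rOut := half_lt_self (by positivity) }
  have hψ : Tendsto (fun n => (ψ n).rOut) atTop (𝓝 0) := tendsto_one_div_add_atTop_nhds_zero_nat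
  let c : ℕ → (Plane → ℂ) → Plane → ℂ := fun n f =>
    (ψ n).normed volume ⋆[ContinuousLinearMap.lsmul ℝ ℝ] f
  have hlim : ∀ {f : Plane → ℂ}, Continuous f → ∀ x, Tendsto (fun n => c n f x) atTop (𝓝 (f x)) :=
    fun hf x => ContDiffBump.convolution_tendsto_right_of_continuous hψ hf x
  have hcont : ∀ n, Continuous (c n F) := fun n =>
    (ψ n).hasCompactSupport_normed.continuous_convolution_left _ (ψ n).continuous_normed
      hF.locallyIntegrable
  have hbd : ∀ n x, ‖c n F x‖ ≤ D := by
    intro n x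
    refine (norm_integral_le_of_norm_le ((ψ n).integrable_normed.mul_const D)
      (Eventually.of_forall fun t => ?_)).trans (le_of_eq ?_)
    · rw [ContinuousLinearMap.lsmul_apply, norm_smul, Real.norm_of_nonneg ((ψ n).nonneg_normed _)]
      exact mul_le_mul_of_nonneg_left (hD _) ((ψ n).nonneg_normed _)
    · rw [integral_mul_const, (ψ n).integral_normed, one_mul]
  have heq : ∀ n, c n f (p + b • e) - c n f (p + a • e) = ∫ s in a..b, c n F (p + s • e) := by
    intro n
    rw [intervalIntegral.integral_eq_sub_of_hasDerivAt
      (fun s _ => hasDerivAt_convolution_of_weak hf h (ψ n) p s)]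
    exact ((hcont n).comp (by fun_prop)).intervalIntegrable _ _
  refine tendsto_nhds_unique ((hlim hf (p + b • e)).sub (hlim hf (p + a • e))) ?_
  simp_rw [heq]
  refine intervalIntegral.tendsto_integral_filter_of_dominated_convergence (fun _ => D)
    (Eventually.of_forall fun n => ((hcont n).comp (by fun_prop)).aestronglyMeasurable)
    (Eventually.of_forall fun n => Eventually.of_forall fun s _ => hbd n _)
    (by simp) (Eventually.of_forall fun s _ => hlim hF _)

end

noncomputable section

/-! ## The Littlewood–Paley expansion of a Besov function -/

theorem lineDiff_comp_mul_left (φ : ℝ → ℂ) {ρ : ℝ} (hρ : ρ ≠ 0) (x₁ x₂ : ℝ) :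
    lineDiff (fun t => φ (ρ * t)) x₁ x₂ = ρ * lineDiff φ (ρ * x₁) (ρ * x₂) := by
  unfold lineDiff
  rcases eq_or_ne x₁ x₂ with rfl | h
  · simp [deriv_comp_mul_left]
  · have h' : ρ * x₁ ≠ ρ * x₂ := fun h' => h (mul_left_cancel₀ hρ h')
    have h1 : (x₁ : ℂ) - x₂ ≠ 0 := by
      rw [← Complex.ofReal_sub]; exact_mod_cast sub_ne_zero.2 h
    have h2 : (ρ : ℂ) ≠ 0 := by exact_mod_cast hρ
    simp only [h, h', if_false]
    rw [← mul_sub]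
    push_cast
    field_simp

/-- The data of a Littlewood–Paley expansion of a continuous function by dilated band-limited
functions, with summable bounds. -/
structure IsBandExpansion (w : ℝ → ℝ) (u : 𝓢'(Plane, ℂ)) (G : ℤ → Plane → ℂ) (M : ℤ → ℝ) :
    Prop where
  measurable : ∀ n, Measurable (G n)
  norm_le : ∀ n z, ‖G n z‖ ≤ M n
  summable : Summable fun n : ℤ => (2 : ℝ) ^ (n + 1) * M n
  tsum_eq : ∑' n : ℤ, ENNReal.ofReal ((2 : ℝ) ^ (n + 1) * M n) = 2 * besovNorm w u
  apply_eq : ∀ (n : ℤ) (φ : 𝓢(Plane, ℂ)), lpPiece w n u φ =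
    ∫ x, φ x * correl (G n) bandKernel ((2 : ℝ) ^ (n + 1) • x)

theorem exists_isBandExpansion {w : ℝ → ℝ} (hw : IsLittlewoodPaleyCutoff w) {u : 𝓢'(Plane, ℂ)}
    (hu : besovNorm w u < ⊤) : ∃ G M, IsBandExpansion w u G M := by
  have hfin : ∀ n : ℤ, distLinftyNorm (lpPiece w n u) < ⊤ := by
    intro n
    have h := ENNReal.ne_top_of_tsum_ne_top hu.ne n
    rw [lt_top_iff_ne_top]
    intro h'
    rw [h', ENNReal.mul_top] at h
    · exact h rfl
    · exact (ENNReal.zpow_pos two_ne_zero ENNReal.ofNat_ne_top n).ne'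
  choose G M hG hM hMn hrep using fun n => exists_lpPiece_eq_correl hw n (hfin n)
  have hM0 : ∀ n, 0 ≤ M n := fun n => (norm_nonneg _).trans (hM n 0)
  -- The factor `2` compares the dilation `2 ^ (n + 1)` with the Besov weight `2 ^ n`.
  have ht : ∑' n : ℤ, ENNReal.ofReal ((2 : ℝ) ^ (n + 1) * M n) = 2 * besovNorm w u := by
    rw [besovNorm, ← ENNReal.tsum_mul_left]
    refine tsum_congr fun n => ?_
    rw [← hMn, ENNReal.ofReal_mul (by positivity), zpow_add_one₀ two_ne_zero, mul_comm _ (2 : ℝ),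
      ENNReal.ofReal_mul zero_le_two, mul_assoc, ENNReal.ofReal_ofNat]
    congr 2
    rw [← Real.rpow_intCast, ← ENNReal.ofReal_rpow_of_pos two_pos, ENNReal.rpow_intCast,
      ENNReal.ofReal_ofNat]
  refine ⟨G, M, hG, hM, ?_, ht, hrep⟩
  have hne : ∑' n : ℤ, ENNReal.ofReal ((2 : ℝ) ^ (n + 1) * M n) ≠ ⊤ := by
    rw [ht]; exact ENNReal.mul_ne_top ENNReal.ofNat_ne_top hu.ne
  have := ENNReal.summable_toReal hne
  refine this.congr fun n => ?_
  rw [ENNReal.toReal_ofReal (mul_nonneg (by positivity) (hM0 n))]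

namespace IsBandExpansion

variable {w : ℝ → ℝ} {u : 𝓢'(Plane, ℂ)} {G : ℤ → Plane → ℂ} {M : ℤ → ℝ}

/-- The derivative in the direction `e` of the `n`-th term of the expansion. -/
def derivTerm (G : ℤ → Plane → ℂ) (e : Plane) (n : ℤ) (x : Plane) : ℂ :=
  ((2 : ℝ) ^ (n + 1) : ℝ) * correl (G n) (-∂_{e} bandKernel) ((2 : ℝ) ^ (n + 1) • x)

theorem bound_nonneg (h : IsBandExpansion w u G M) (n : ℤ) : 0 ≤ M n :=
  (norm_nonneg _).trans (h.norm_le n 0)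

theorem hasDerivAt_term (h : IsBandExpansion w u G M) {e : Plane} (he : ‖e‖ ≤ 1) (n : ℤ)
    (p : Plane) (t : ℝ) :
    HasDerivAt (fun t : ℝ => correl (G n) bandKernel ((2 : ℝ) ^ (n + 1) • (p + t • e)))
      (derivTerm G e n (p + t • e)) t := by
  have h1 := hasDerivAt_correl (h.measurable n) (h.norm_le n) bandKernel
    ((2 : ℝ) ^ (n + 1) • p) he ((2 : ℝ) ^ (n + 1) * t)
  have h2 : HasDerivAt (fun t : ℝ => (2 : ℝ) ^ (n + 1) * t) ((2 : ℝ) ^ (n + 1)) t := by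
    simpa using (hasDerivAt_id t).const_mul ((2 : ℝ) ^ (n + 1))
  have h3 := h1.scomp t h2
  simp only [Function.comp_def, mul_smul, ← smul_add] at h3
  exact h3

theorem norm_derivTerm_le (h : IsBandExpansion w u G M) (e : Plane) (n : ℤ) (x : Plane) :
    ‖derivTerm G e n x‖ ≤ (2 : ℝ) ^ (n + 1) * M n * bandBound e := by
  rw [derivTerm, norm_mul, Complex.norm_real, Real.norm_of_nonneg (by positivity), mul_assoc]
  gcongr
  exact norm_correl_deriv_bandKernel_le (h.norm_le n) e _

theorem continuous_derivTerm (h : IsBandExpansion w u G M) (e : Plane) (n : ℤ) :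
    Continuous (derivTerm G e n) :=
  continuous_const.mul ((continuous_correl (h.measurable n) (h.norm_le n) _).comp
    (continuous_const_smul _))

theorem continuous_tsum_derivTerm (h : IsBandExpansion w u G M) (e : Plane) :
    Continuous fun x => ∑' n, derivTerm G e n x :=
  continuous_tsum (h.continuous_derivTerm e) (h.summable.mul_right _)
    fun n x => h.norm_derivTerm_le e n x

theorem norm_tsum_derivTerm_le (h : IsBandExpansion w u G M) (e x : Plane) :
    ‖∑' n, derivTerm G e n x‖ ≤ ∑' n : ℤ, (2 : ℝ) ^ (n + 1) * M n * bandBound e :=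
  tsum_of_norm_bounded (h.summable.mul_right _).hasSum fun n => h.norm_derivTerm_le e n x

theorem lineDeriv_lpPiece_apply (h : IsBandExpansion w u G M) {e : Plane} (he : ‖e‖ ≤ 1) (n : ℤ)
    (φ : 𝓢(Plane, ℂ)) :
    (∂_{e} (lpPiece w n u)) φ = ∫ x, φ x * derivTerm G e n x := by
  rw [TemperedDistribution.lineDerivOp_apply_apply, map_neg, h.apply_eq]
  have hc : Continuous fun x : Plane => correl (G n) bandKernel ((2 : ℝ) ^ (n + 1) • x) :=
    (continuous_correl (h.measurable n) (h.norm_le n) _).comp (continuous_const_smul _)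
  have hb : ∀ x : Plane, ‖correl (G n) bandKernel ((2 : ℝ) ^ (n + 1) • x)‖ ≤ M n * bandBound e :=
    fun x => norm_correl_bandKernel_le (h.norm_le n) e _
  have hibp := integral_bilinear_hasLineDerivAt_right_eq_neg_left_of_integrable
    (μ := (volume : Measure Plane)) (B := ContinuousLinearMap.mul ℝ ℂ) (v := e)
    (f := φ) (f' := (∂_{e} φ : 𝓢(Plane, ℂ)))
    (g := fun x => correl (G n) bandKernel ((2 : ℝ) ^ (n + 1) • x))
    (g' := derivTerm G e n)
    ((∂_{e} φ : 𝓢(Plane, ℂ)).integrable.mul_bdd hc.aestronglyMeasurable (Eventually.of_forall hb))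
    (φ.integrable.mul_bdd (h.continuous_derivTerm e n).aestronglyMeasurable
      (Eventually.of_forall (h.norm_derivTerm_le e n)))
    (φ.integrable.mul_bdd hc.aestronglyMeasurable (Eventually.of_forall hb))
    (fun x _ => by
      rw [SchwartzMap.lineDerivOp_apply_eq_fderiv]
      exact (φ.hasFDerivAt x).hasLineDerivAt e)
    (fun x _ => by
      have := h.hasDerivAt_term he n x 0
      simpa [HasLineDerivAt] using this)
  simp only [ContinuousLinearMap.mul_apply'] at hibp
  rw [hibp]

theorem hasSum_integral_derivTerm (h : IsBandExpansion w u G M) (e : Plane) (φ : 𝓢(Plane, ℂ)) :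
    HasSum (fun n => ∫ x, φ x * derivTerm G e n x) (∫ x, φ x * ∑' n, derivTerm G e n x) := by
  have := hasSum_integral_of_summable_integral_norm (μ := volume)
    (F := fun n x => φ x * derivTerm G e n x)
    (fun n => φ.integrable.mul_bdd (h.continuous_derivTerm e n).aestronglyMeasurable
      (Eventually.of_forall (h.norm_derivTerm_le e n))) (by
    refine Summable.of_nonneg_of_le (fun n => integral_nonneg fun _ => norm_nonneg _) (fun n => ?_)
      ((h.summable.mul_right (bandBound e)).mul_left (∫ x, ‖φ x‖))
    rw [← integral_mul_const]
    refine integral_mono_of_nonneg (Eventually.of_forall fun _ => norm_nonneg _)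
      (φ.integrable.norm.mul_const _) (Eventually.of_forall fun x => ?_)
    simp only [norm_mul]
    gcongr
    exact h.norm_derivTerm_le e n x)
  simp_rw [tsum_mul_left] at this
  exact this

variable {f : Plane → ℂ}

/-- Here the convergence condition of the Besov class enters: the seminorm ignores polynomials, and
the condition identifies the sum of the derivatives with the weak derivative of `f`. -/
theorem integral_lineDeriv_mul (h : IsBandExpansion w u G M) (hu : MemBesov w u)
    (hfu : IsGivenBy u f) (j : Fin 2) (φ : 𝓢(Plane, ℂ)) (hφ : HasCompactSupport φ) :
    ∫ x, (∂_{(EuclideanSpace.single j 1 : Plane)} φ) x * f x =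
      -∫ x, φ x * ∑' n, derivTerm G (EuclideanSpace.single j 1) n x := by
  set e : Plane := EuclideanSpace.single j 1
  have he : ‖e‖ ≤ 1 := by simp [e]
  have hcs : HasCompactSupport (∂_{e} φ : 𝓢(Plane, ℂ)) :=
    hφ.mono' ((subset_tsupport _).trans (SchwartzMap.tsupport_lineDerivOp_subset e φ))
  rw [← hfu _ hcs, ← neg_eq_iff_eq_neg, ← map_neg]
  change (∂_{e} u) φ = _
  have h1 : HasSum (fun n => (∂_{e} (lpPiece w n u)) φ) ((∂_{e} u) φ) :=
    (hu.hasSum_deriv j).mapL (PointwiseConvergenceCLM.evalCLM (RingHom.id ℂ) ℂ φ)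
  simp_rw [h.lineDeriv_lpPiece_apply he] at h1
  exact h1.unique (h.hasSum_integral_derivTerm e φ)

theorem hasDerivAt (h : IsBandExpansion w u G M) (hu : MemBesov w u) (hf : Continuous f)
    (hfu : IsGivenBy u f) (j : Fin 2) (p : Plane) (t : ℝ) :
    HasDerivAt (fun t : ℝ => f (p + t • (EuclideanSpace.single j 1 : Plane)))
      (∑' n, derivTerm G (EuclideanSpace.single j 1) n
        (p + t • (EuclideanSpace.single j 1 : Plane))) t := by
  set e : Plane := EuclideanSpace.single j 1
  have hc := h.continuous_tsum_derivTerm e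
  have hsub := sub_eq_intervalIntegral_of_weak hf hc (h.norm_tsum_derivTerm_le e)
    (h.integral_lineDeriv_mul hu hfu j) p 0
  have hfun : (fun t : ℝ => f (p + t • e)) =
      fun t => (∫ s in (0 : ℝ)..t, ∑' n, derivTerm G e n (p + s • e)) + f (p + (0 : ℝ) • e) := by
    ext t
    rw [← hsub t, sub_add_cancel]
  rw [hfun]
  have hc' : Continuous fun s : ℝ => ∑' n, derivTerm G e n (p + s • e) := hc.comp (by fun_prop)
  exact (hc'.integral_hasStrictDerivAt 0 t).hasDerivAt.add_const _

/-- The expansion is available for derivatives only, since the pieces of `f` do not see constants;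
integrating it over the segment yields the divided differences. -/
theorem hasSum_lineDiff (h : IsBandExpansion w u G M) (hu : MemBesov w u) (hf : Continuous f)
    (hfu : IsGivenBy u f) (j : Fin 2) (p : Plane) (x₁ x₂ : ℝ) :
    HasSum (fun n : ℤ => (((2 : ℝ) ^ (n + 1) : ℝ) : ℂ) *
      lineDiff (fun t : ℝ => correl (G n) bandKernel ((2 : ℝ) ^ (n + 1) • p + t • (EuclideanSpace.single j 1 : Plane)))
      ((2 : ℝ) ^ (n + 1) * x₁) ((2 : ℝ) ^ (n + 1) * x₂))
      (lineDiff (fun t => f (p + t • (EuclideanSpace.single j 1 : Plane))) x₁ x₂) := by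
  set e : Plane := EuclideanSpace.single j 1
  have he : ‖e‖ ≤ 1 := by simp [e]
  have h1 : ∀ n : ℤ, (((2 : ℝ) ^ (n + 1) : ℝ) : ℂ) * lineDiff (fun t : ℝ => correl (G n) bandKernel
      ((2 : ℝ) ^ (n + 1) • p + t • e)) ((2 : ℝ) ^ (n + 1) * x₁) ((2 : ℝ) ^ (n + 1) * x₂) =
      ∫ s in Set.Ioc (0 : ℝ) 1, derivTerm G e n (p + (s * x₁ + (1 - s) * x₂) • e) := by
    intro n
    rw [← lineDiff_comp_mul_left _ (by positivity)]
    simp only [mul_smul, ← smul_add]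
    exact lineDiff_eq_integral (h.hasDerivAt_term he n p)
      ((h.continuous_derivTerm e n).comp (by fun_prop)) x₁ x₂
  simp_rw [h1]
  rw [lineDiff_eq_integral (h.hasDerivAt hu hf hfu j p)
    ((h.continuous_tsum_derivTerm e).comp (by fun_prop))]
  refine hasSum_integral_of_summable_integral_norm (fun n => ?_) ?_
  · have : Continuous fun s : ℝ => derivTerm G e n (p + (s * x₁ + (1 - s) * x₂) • e) :=
      (h.continuous_derivTerm e n).comp (by fun_prop)
    exact (this.integrableOn_Icc).mono_set Set.Ioc_subset_Icc_self
  · refine Summable.of_nonneg_of_le (fun n => integral_nonneg fun _ => norm_nonneg _) (fun n => ?_)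
      (h.summable.mul_right (bandBound e))
    refine (integral_mono_of_nonneg (Eventually.of_forall fun _ => norm_nonneg _)
      (integrable_const ((2 : ℝ) ^ (n + 1) * M n * bandBound e))
      (Eventually.of_forall fun s => h.norm_derivTerm_le e n _)).trans (by simp)

theorem exists_haagerup_representation (h : IsBandExpansion w u G M) (hu : MemBesov w u)
    (hf : Continuous f) (hfu : IsGivenBy u f) (j : Fin 2) {p : ℝ → Plane} (hp : Continuous p) :
    ∃ (α : ℕ → ℝ → ℂ) (g : ℕ → ℕ → ℝ → ℂ), (∀ j, Measurable (α j)) ∧ (∀ j k, Measurable (g j k)) ∧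
      (∀ x, ell2Norm (fun j => α j x) ≤
        (ENNReal.ofReal (samplingBound ^ 2) * (2 * besovNorm w u)) ^ (1 / 2 : ℝ)) ∧
      (∀ y, matrixNorm (fun j k => g j k y) ≤ ENNReal.ofReal
        (bandBound (EuclideanSpace.single j 1) * (2 * Real.pi + 1))) ∧
      ∀ x₁ x₂ y, Tendsto (fun p : ℕ × ℕ => ∑ j ∈ Finset.range p.1, ∑ k ∈ Finset.range p.2,
        α j x₁ * α k x₂ * g j k y) atTop
        (𝓝 (lineDiff (fun t => f (p y + t • (EuclideanSpace.single j 1 : Plane))) x₁ x₂)) := by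
  set e : Plane := EuclideanSpace.single j 1
  have he : ‖e‖ ≤ 1 := by simp [e]
  have hpi := Real.pi_pos
  have hbb := bandBound_nonneg e
  let D : ℤ → ℝ → ℝ → ℝ → ℂ := fun n x₁ x₂ y => lineDiff (fun t : ℝ => correl (G n) bandKernel
    ((2 : ℝ) ^ (n + 1) • p y + t • e)) x₁ x₂
  have hD : ∀ n x₁ x₂ y, ‖D n x₁ x₂ y‖ ≤ M n * bandBound e := fun n x₁ x₂ y =>
    norm_lineDiff_correl_le (h.measurable n) (h.norm_le n) _ he _ _
  have hM0 := h.bound_nonneg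
  have hinv : ∀ n, ‖((M n)⁻¹ : ℂ)‖ = (M n)⁻¹ := fun n => by
    rw [norm_inv, Complex.norm_real, Real.norm_of_nonneg (hM0 n)]
  -- Only an inequality, because `M n` may be zero and then its inverse is zero.
  have hcancel : ∀ n (c : ℝ), 0 ≤ c → (M n)⁻¹ * (M n * c) ≤ c := fun n c hc => by
    rw [← mul_assoc]
    exact mul_le_of_le_one_left hc inv_mul_le_one
  rw [← h.tsum_eq]
  refine _root_.exists_haagerup_representation (ρ := fun n => (2 : ℝ) ^ (n + 1))
    (γ := fun n j k y => ((M n)⁻¹ : ℂ) * D n j k y)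
    (d := fun n x₁ x₂ y => ((M n)⁻¹ : ℂ) *
      D n ((2 : ℝ) ^ (n + 1) * x₁) ((2 : ℝ) ^ (n + 1) * x₂) y)
    (fun n => mul_nonneg (by positivity) (hM0 n)) h.summable (by positivity)
    (fun n j k => ?_) (fun n j k y => ?_) (fun n y => ?_) (fun n x₁ x₂ y => ?_)
    (fun x₁ x₂ y => ?_)
  · exact (continuous_const.mul (continuous_lineDiff_correl (h.measurable n) (h.norm_le n)
      (hp.const_smul ((2 : ℝ) ^ (n + 1))) he _ _)).measurable
  · rw [norm_mul, hinv]
    have h1 : (M n)⁻¹ * ‖D n j k y‖ ≤ (M n)⁻¹ * (M n * bandBound e) :=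
      mul_le_mul_of_nonneg_left (hD n j k y) (inv_nonneg.2 (hM0 n))
    refine (h1.trans (hcancel n _ hbb)).trans ?_
    nlinarith
  · have h1 := (bilinearBound_lineDiff_correl (h.measurable n) (h.norm_le n)
      ((2 : ℝ) ^ (n + 1) • p y) he).const_mul ((M n)⁻¹ : ℂ)
    rw [hinv] at h1
    exact h1.mono (hcancel n _ (by positivity))
  · have h1 := (hasSum_lineDiff_correl (h.measurable n) (h.norm_le n)
      ((2 : ℝ) ^ (n + 1) • p y) he ((2 : ℝ) ^ (n + 1) * x₁) ((2 : ℝ) ^ (n + 1) * x₂)).mul_left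
      ((M n)⁻¹ : ℂ)
    simp_rw [mul_left_comm ((M n)⁻¹ : ℂ)] at h1
    exact h1
  · have h1 := h.hasSum_lineDiff hu hf hfu j (p y) x₁ x₂
    convert h1 using 2 with n
    change _ * (_ * D n _ _ y) = _ * D n _ _ y
    -- If `M n = 0`, dividing by it loses nothing, since the whole `n`-th term vanishes.
    rcases (hM0 n).eq_or_lt with h0 | h0
    · have : D n ((2 : ℝ) ^ (n + 1) * x₁) ((2 : ℝ) ^ (n + 1) * x₂) y = 0 := by
        have := hD n ((2 : ℝ) ^ (n + 1) * x₁) ((2 : ℝ) ^ (n + 1) * x₂) y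
        rw [← h0, zero_mul] at this
        exact norm_le_zero_iff.1 this
      rw [this, mul_zero, mul_zero, mul_zero]
    · have : (M n : ℂ) ≠ 0 := by exact_mod_cast h0.ne'
      rw [Complex.ofReal_mul, mul_assoc, mul_inv_cancel_left₀ this]

end IsBandExpansion

/-! ## Essential suprema with respect to spectral measures -/

section

variable {X H : Type*} [MeasurableSpace X] [NormedAddCommGroup H] [InnerProductSpace ℂ H]
  [CompleteSpace H]

/-- Countable additivity for a sequence of empty sets makes a constant series summable, so its term
is zero. -/
theorem SpectralMeasure.proj_empty (E : SpectralMeasure X H) : E.proj ∅ = 0 := by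
  ext v
  have h := (E.hasSum_proj (fun _ => ∅) (fun _ => MeasurableSet.empty)
    (fun _ _ _ => disjoint_bot_left) v).summable
  simpa using (summable_const_iff _).1 h

theorem SpectralMeasure.essSup_le (E : SpectralMeasure X H) {g : X → ℝ≥0∞} {c : ℝ≥0∞}
    (h : ∀ x, g x ≤ c) : E.essSup g ≤ c :=
  sInf_le ⟨∅, MeasurableSet.empty, E.proj_empty, fun x _ => h x⟩

end

/-! ### Constants, coordinate lines and the final estimate -/

theorem ENNReal.rpow_half_mul_self (R : ℝ≥0∞) : R ^ (1 / 2 : ℝ) * R ^ (1 / 2 : ℝ) = R := by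
  rw [← ENNReal.rpow_add_of_nonneg _ _ (by norm_num) (by norm_num)]
  norm_num

/-- The constant in the estimate of the divided difference in the `j`-th variable. -/
def haagerupConst (j : Fin 2) : ℝ≥0 :=
  (samplingBound ^ 2 * 2 * (bandBound (EuclideanSpace.single j 1) * (2 * Real.pi + 1))).toNNReal

theorem coe_haagerupConst_mul (j : Fin 2) (b : ℝ≥0∞) : (haagerupConst j : ℝ≥0∞) * b =
    ENNReal.ofReal (samplingBound ^ 2) * (2 * b) *
      ENNReal.ofReal (bandBound (EuclideanSpace.single j 1) * (2 * Real.pi + 1)) := by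
  change ENNReal.ofReal _ * b = _
  rw [ENNReal.ofReal_mul (by positivity), ENNReal.ofReal_mul (by positivity)]
  simp only [ENNReal.ofReal_ofNat]
  ring

theorem plane_eq_add_smul_single_zero (t y : ℝ) :
    (!₂[t, y] : Plane) = !₂[0, y] + t • EuclideanSpace.single 0 1 := by
  ext i; fin_cases i <;> simp

theorem plane_eq_add_smul_single_one (x t : ℝ) :
    (!₂[x, t] : Plane) = !₂[x, 0] + t • EuclideanSpace.single 1 1 := by
  ext i; fin_cases i <;> simp

theorem dividedDiff₁_eq_lineDiff (f : Plane → ℂ) (x₁ x₂ y : ℝ) : dividedDiff₁ f x₁ x₂ y =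
    lineDiff (fun t => f (!₂[0, y] + t • EuclideanSpace.single 0 1)) x₁ x₂ := by
  simp only [← plane_eq_add_smul_single_zero]
  rfl

theorem dividedDiff₂_eq_lineDiff (f : Plane → ℂ) (x y₁ y₂ : ℝ) : dividedDiff₂ f x y₁ y₂ =
    lineDiff (fun t => f (!₂[x, 0] + t • EuclideanSpace.single 1 1)) y₁ y₂ := by
  simp only [← plane_eq_add_smul_single_one]
  rfl

end

theorem theorem6p3 :
    ∃ C : ℝ≥0, ∀ (w : ℝ → ℝ), IsLittlewoodPaleyCutoff w →
      ∀ (u : 𝓢'(Plane, ℂ)) (f : Plane → ℂ), MemBesov w u → Continuous f → IsGivenBy u f →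
        (∀ x y : ℝ, DifferentiableAt ℝ (fun t : ℝ => f !₂[t, y]) x ∧
          DifferentiableAt ℝ (fun t : ℝ => f !₂[x, t]) y) ∧
        ∀ (H : Type*) [NormedAddCommGroup H] [InnerProductSpace ℂ H] [CompleteSpace H]
          (E₁ E₂ E₃ : SpectralMeasure ℝ H),
          (MemFirstKind E₁ E₂ E₃ (dividedDiff₁ f) ∧
            firstKindNorm E₁ E₂ E₃ (dividedDiff₁ f) ≤ C * besovNorm w u) ∧
          (MemSecondKind E₁ E₂ E₃ (dividedDiff₂ f) ∧
            secondKindNorm E₁ E₂ E₃ (dividedDiff₂ f) ≤ C * besovNorm w u) := by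
  refine ⟨haagerupConst 0 + haagerupConst 1, fun w hw u f hu hf hfu => ?_⟩
  obtain ⟨G, M, h⟩ := exists_isBandExpansion hw hu.norm_lt_top
  refine ⟨fun x y => ⟨?_, ?_⟩, fun H _ _ _ E₁ E₂ E₃ => ?_⟩
  · rw [funext fun t => congrArg f (plane_eq_add_smul_single_zero t y)]
    exact (h.hasDerivAt hu hf hfu 0 _ x).differentiableAt
  · rw [funext fun t => congrArg f (plane_eq_add_smul_single_one x t)]
    exact (h.hasDerivAt hu hf hfu 1 _ y).differentiableAt
  have hR : (ENNReal.ofReal (samplingBound ^ 2) * (2 * besovNorm w u)) ^ (1 / 2 : ℝ) < ⊤ :=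
    ENNReal.rpow_lt_top_of_nonneg (by norm_num) (ENNReal.mul_ne_top ENNReal.ofReal_ne_top
      (ENNReal.mul_ne_top ENNReal.ofNat_ne_top hu.norm_lt_top.ne))
  have hC : ∀ j, (haagerupConst j : ℝ≥0∞) * besovNorm w u ≤
      ((haagerupConst 0 + haagerupConst 1 : ℝ≥0) : ℝ≥0∞) * besovNorm w u := by
    intro j
    gcongr
    fin_cases j
    · exact le_self_add
    · exact le_add_self
  constructor
  · obtain ⟨α, g, hα, hg, hαn, hgn, ht⟩ := h.exists_haagerup_representation hu hf hfu 0
      (p := fun y => !₂[0, y]) (by fun_prop)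
    simp only [← dividedDiff₁_eq_lineDiff] at ht
    let r : FirstKindRep E₁ E₂ E₃ (dividedDiff₁ f) := ⟨α, α, g, hα, hα, hg,
      (E₁.essSup_le hαn).trans_lt hR, (E₂.essSup_le hαn).trans_lt hR,
      (E₃.essSup_le hgn).trans_lt ENNReal.ofReal_lt_top, ht⟩
    refine ⟨⟨r⟩, (iInf_le _ r).trans (le_trans ?_ (hC 0))⟩
    -- Each of the two vector norms is at most the square root of the same multiple of the Besov
    -- norm, so their product is linear in it.
    rw [coe_haagerupConst_mul, ← ENNReal.rpow_half_mul_self (_ * (2 * _))]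
    gcongr
    exacts [E₁.essSup_le hαn, E₂.essSup_le hαn, E₃.essSup_le hgn]
  · obtain ⟨α, g, hα, hg, hαn, hgn, ht⟩ := h.exists_haagerup_representation hu hf hfu 1
      (p := fun x => !₂[x, 0]) (by fun_prop)
    simp only [← dividedDiff₂_eq_lineDiff] at ht
    -- The frozen variable is now the first one, so the matrix takes the first slot and the
    -- variables are permuted cyclically.
    let r : SecondKindRep E₁ E₂ E₃ (dividedDiff₂ f) := ⟨g, α, α, hg, hα, hα,
      (E₁.essSup_le hgn).trans_lt ENNReal.ofReal_lt_top, (E₂.essSup_le hαn).trans_lt hR,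
      (E₃.essSup_le hαn).trans_lt hR, fun x₁ x₂ x₃ => (ht x₂ x₃ x₁).congr fun q =>
        Finset.sum_congr rfl fun _ _ => Finset.sum_congr rfl fun _ _ => by ring⟩
    refine ⟨⟨r⟩, (iInf_le _ r).trans (le_trans ?_ (hC 1))⟩
    rw [coe_haagerupConst_mul, ← ENNReal.rpow_half_mul_self (_ * (2 * _)), mul_assoc, mul_comm]
    gcongr
    exacts [E₂.essSup_le hαn, E₃.essSup_le hαn, E₁.essSup_le hgn]
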